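/- Let $R$ be a number ring, i.e. a subring of a number field $K$ (a finite extension of $\mathbb{Q}$), and let $\tilde R$ be its normalization, i.e. the integral closure of $R$ in its field of fractions. For an ideal $I$ of a commutative ring $A$ write $N(I)=[A:I]$ for its index as an additive subgroup, when this is finite. Call $A$ super-multiplicative if $N(IJ)\ge N(I)N(J)$ for all ideals $I,J$ of $A$ such that $[A:IJ]$ is finite (when $A$ is a number ring, these are exactly the pairs of non-zero ideals). The following statements are equivalent: (i) every ideal of $R$ can be generated by $3$ elements; (ii) every ring $R'$ with $R\subseteq R'\subseteq\tilde R$ is super-multiplicative. -/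

import Mathlib

/-- The norm of an ideal `I` of a commutative ring `A`: its index `[A : I]` as an additive
subgroup (with the usual convention that the value is `0` if the index is infinite). -/
noncomputable def idealNorm {A : Type*} [CommRing A] (I : Ideal A) : ℕ :=
  I.toAddSubgroup.index

/-- A commutative ring `A` is super-multiplicative if `N(I) N(J) ≤ N(IJ)` for all ideals `I`, `J`
such that `IJ` has finite index in `A` (so that `I` and `J` have finite index as well). -/
def IsSuperMultiplicative (A : Type*) [CommRing A] : Prop :=
  ∀ I J : Ideal A, (I * J).toAddSubgroup.FiniteIndex →
    idealNorm I * idealNorm J ≤ idealNorm (I * J)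

/-!
Throughout, `N(I)` is `Submodule.cardQuot I`, and the nonzero ideals of
a number ring have finite index (`hasFiniteQuotients_of_injective_numberField`), so that a
number ring is Noetherian of dimension at most one.

**Three generators imply super-multiplicativity.** If all ideals of `R` have three generators, so do
those of an overring `R'`, by clearing denominators (`exists_eq_span_of_overring`). By the Chinese
remainder theorem one may assume that `IJ` lies in at most one maximal ideal `m`. The space
`W = IJ / mIJ` has dimension at most three and is spanned by products, and linear algebra
(`exists_row_or_column_sup_span_singleton_eq_top`) shows that, up to exchanging `I` and `J`, there
are `x, a ∈ I` and `b ∈ J` for which `xJ` and `ab` span `W`. After a correction at the other maximal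
ideals, `IJ = xJ + (ab)`. So `IJ / xJ` is cyclic, generated by `ab`, and any `r` with `ra ∈ (x)`
satisfies `r ab ∈ xJ`; hence `[IJ : xJ] ≤ [I : (x)]`, and comparison with `N(xJ) = N((x)) N(J)`
gives `N(I) N(J) ≤ N(IJ)` (`cardQuot_mul_le_of_mul_le_sup`).

**Super-multiplicativity implies three generators.** Let `O` be the normalization of `R`, a Dedekind
domain, and `m` a maximal ideal of `R` with residue field `k`. If `B = O / mO` had dimension at least
four over `k`, then, since the ideals of `B` are principal, there would be `a, b` with `1, a, b, ab`
linearly independent in `B` (`exists_mul_notMem_span`). In the ring `R' = R + mO` the fractional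
ideals `R' + R'a` and `R' + R'b` have index at most `|k|` over `R'`, while their product has index at
least `|k| ^ 3`, so that `R'` is not super-multiplicative
(`not_isSuperMultiplicative_scalarOverring`). Therefore `dim B ≤ 3`.

This bound passes to `I / mI` for every ideal `I` of `R` (`relCard_smul_self_le`). For an `R`-module
`V` between an ideal `L` of `O` and `m ^ n L` the bound amounts to `[mL : mV] ≤ [L : V]`, which is
proved along the filtration of `L` by the `m ^ i L`. On a single layer it is a statement on the pairing
of `m` with `L / mL`, a space of dimension at most three (`relCard_smul_le_of_smul_le`); this is an
argument over an arbitrary residue field, and does not need an element of `m` generating `mO`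
locally. The passage from `V` to `I` uses that the conductor of `R` in `O` is nonzero
(`exists_mul_mem_range_of_isIntegral`). Finally, an ideal with `dim I / mI ≤ 3` for all `m` is
generated by three elements (`exists_eq_span_of_relCard_smul_le`).
-/

open Module Submodule

open scoped nonZeroDivisors

/-! ### Finite quotients of number rings -/

/-- A subring `A` of a number field of degree `d` has finite quotients: a nonzero ideal contains an
integer `n ≠ 0`, and `A / nA` has at most `n ^ d` elements, as every finitely generated subgroup of
`A` is free of rank at most `d`. -/
theorem hasFiniteQuotients_of_injective_numberField {A K : Type*} [CommRing A] [Field K]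
    [NumberField K] (f : A →+* K) (hf : Function.Injective f) : Ring.HasFiniteQuotients A where
  finiteQuotient {I} hI := by
    have : IsDomain A := hf.isDomain f
    obtain ⟨a, haI, ha⟩ := Submodule.exists_mem_ne_zero_of_ne_bot hI
    have halg : IsAlgebraic ℤ a := by
      have h1 : IsAlgebraic ℤ (f a) :=
        (IsFractionRing.isAlgebraic_iff ℤ ℚ K).mpr (Algebra.IsAlgebraic.isAlgebraic (f a))
      obtain ⟨p, hp, hpa⟩ := h1
      refine ⟨p, hp, hf ?_⟩
      rw [map_zero, ← hpa, Polynomial.aeval_def, Polynomial.aeval_def, Polynomial.hom_eval₂]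
      congr 1
      exact RingHom.ext_int _ _
    obtain ⟨n, hn, hdvd⟩ := halg.exists_nonzero_dvd (mem_nonZeroDivisors_of_ne_zero ha)
    have hnI : (n : A) ∈ I := I.mem_of_dvd (by simpa using hdvd) haI
    by_contra hinf
    rw [not_finite_iff_infinite] at hinf
    obtain ⟨s, -, hs⟩ := Set.infinite_univ.exists_subset_card_eq (α := A ⧸ I)
      (n.natAbs ^ finrank ℚ K + 1)
    let lift : A ⧸ I → A := Quotient.out
    -- The group generated by representatives of too many residue classes.
    let M : Submodule ℤ A := Submodule.span ℤ (lift '' s)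
    have hMfg : Module.Finite ℤ M := Module.Finite.span_of_finite ℤ (s.finite_toSet.image _)
    let g : A →ₗ[ℤ] K := f.toAddMonoidHom.toIntLinearMap
    have hg : Function.Injective g := hf
    have htf : Module.IsTorsionFree ℤ A :=
      Function.Injective.moduleIsTorsionFree g hg fun r m => g.map_smul r m
    have hrank : finrank ℤ M ≤ finrank ℚ K := by
      let b := Module.Free.chooseBasis ℤ M
      have h1 : LinearIndependent ℤ fun i => g (b i : A) :=
        (b.linearIndependent.map' M.subtype M.ker_subtype).map' g (LinearMap.ker_eq_bot.mpr hg)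
      have h2 := (LinearIndependent.iff_fractionRing ℤ ℚ).mp h1
      rw [finrank_eq_card_chooseBasisIndex]
      exact h2.fintype_card_le_finrank
    have hN : NeZero n.natAbs := ⟨by simpa using hn⟩
    have hcard := ModN.natCard_eq (G := M) (n := n.natAbs)
    have hfin : Finite (ModN M n.natAbs) := Nat.finite_of_card_ne_zero (by
      rw [hcard]; exact pow_ne_zero _ hN.out)
    -- Representatives congruent modulo `n M` are congruent modulo `I`.
    let e : s → ModN M n.natAbs := fun t =>
      Submodule.Quotient.mk ⟨lift t.1, Submodule.subset_span ⟨t.1, t.2, rfl⟩⟩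
    have he : Function.Injective e := by
      intro t u htu
      obtain ⟨w, hw⟩ := (Submodule.Quotient.eq _).mp htu
      have hw' : (n.natAbs : A) * (w : A) = lift t.1 - lift u.1 := by
        have := congrArg (Subtype.val) hw
        simpa using this
      have hmem : lift t.1 - lift u.1 ∈ I := by
        rw [← hw']
        refine I.mul_mem_right _ ?_
        rcases Int.natAbs_eq n with h | h
        · rw [h] at hnI; simpa using hnI
        · rw [h] at hnI; simpa using hnI
      apply Subtype.ext
      have := (Ideal.Quotient.eq (I := I)).mpr hmem
      simpa [lift] using this
    have h3 := Nat.card_le_card_of_injective e he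
    rw [hcard, Nat.card_eq_fintype_card, Fintype.card_coe, hs] at h3
    have h4 : n.natAbs ^ finrank ℤ M ≤ n.natAbs ^ finrank ℚ K :=
      Nat.pow_le_pow_right (Nat.pos_of_ne_zero hN.out) hrank
    omega

/-! ### Pairings into a space of dimension at most three -/

theorem linearIndependent_pair_of_ne {k W ι : Type*} [Field k] [AddCommGroup W] [Module k W]
    {f : ι → W} (hf : LinearIndependent k f) {i j : ι} (hij : i ≠ j) :
    LinearIndependent k ![f i, f j] := by
  have := hf.comp ![i, j] (by
    intro a b hab
    fin_cases a <;> fin_cases b <;> simp_all)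
  convert! this using 1
  ext a
  fin_cases a <;> rfl

theorem two_le_finrank_of_linearIndependent_pair {k W : Type*} [Field k] [AddCommGroup W]
    [Module k W] [FiniteDimensional k W] {U : Submodule k W} {u v : W}
    (h : LinearIndependent k ![u, v]) (hu : u ∈ U) (hv : v ∈ U) : 2 ≤ finrank k U := by
  have h1 := finrank_span_eq_card h
  have h2 : Submodule.span k (Set.range ![u, v]) ≤ U := by
    rw [Submodule.span_le]
    rintro _ ⟨i, rfl⟩
    fin_cases i
    · exact hu
    · exact hv
  have h3 := Submodule.finrank_mono h2
  rw [h1] at h3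
  simpa using h3

theorem exists_smul_eq_of_finrank_lt_two {k W : Type*} [Field k] [AddCommGroup W]
    [Module k W] [FiniteDimensional k W] {U : Submodule k W} (hU : finrank k U < 2) {u v : W}
    (hu : u ∈ U) (hv : v ∈ U) (hu0 : u ≠ 0) : ∃ c : k, c • u = v := by
  by_contra! h
  have := two_le_finrank_of_linearIndependent_pair ((LinearIndependent.pair_iff' hu0).mpr h) hu hv
  omega

/-- A row of codimension at most one in the span of all values is completed by a single value. -/
theorem span_range_sup_span_singleton_eq_top {k W X Y : Type*} [Field k] [AddCommGroup W]
    [Module k W] [FiniteDimensional k W] (P : X → Y → W)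
    (hspan : Submodule.span k (Set.range fun p : X × Y => P p.1 p.2) = ⊤) (x : X) [Nonempty Y]
    (hx : finrank k W ≤ finrank k (Submodule.span k (Set.range (P x))) + 1) :
    ∃ a b, Submodule.span k (Set.range (P x)) ⊔ Submodule.span k {P a b} = ⊤ := by
  by_cases htop : Submodule.span k (Set.range (P x)) = ⊤
  · exact ⟨x, Classical.arbitrary Y, by rw [htop, top_sup_eq]⟩
  · have : ∃ a b, P a b ∉ Submodule.span k (Set.range (P x)) := by
      by_contra! h
      apply htop
      rw [eq_top_iff, ← hspan, Submodule.span_le]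
      rintro _ ⟨⟨a, b⟩, rfl⟩
      exact h a b
    obtain ⟨a, b, hab⟩ := this
    refine ⟨a, b, Submodule.eq_top_of_finrank_eq ?_⟩
    have hlt : Submodule.span k (Set.range (P x)) <
        Submodule.span k (Set.range (P x)) ⊔ Submodule.span k {P a b} := by
      refine lt_of_le_of_ne le_sup_left fun h => hab ?_
      rw [h]
      exact Submodule.mem_sup_right (Submodule.mem_span_singleton_self _)
    have h1 := Submodule.finrank_lt_finrank_of_lt hlt
    have h2 := Submodule.finrank_le
      (Submodule.span k (Set.range (P x)) ⊔ Submodule.span k {P a b})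
    omega

/-- A biadditive pairing whose values span a space of dimension at most three has a row or a column
that spans a subspace of codimension at most one. If all rows and columns had rank one, values
`P aᵢ bᵢ` forming a basis would satisfy `P aᵢ bⱼ = 0` for `i ≠ j`, and the row of `a₀ + a₁` would
have rank two. -/
theorem exists_row_or_column_sup_span_singleton_eq_top {k W X Y : Type*} [Field k]
    [AddCommGroup W] [Module k W] [FiniteDimensional k W] [Nontrivial W] [Add X] (P : X → Y → W)
    (hadd : ∀ x x' y, P (x + x') y = P x y + P x' y)
    (hspan : Submodule.span k (Set.range fun p : X × Y => P p.1 p.2) = ⊤)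
    (hdim : finrank k W ≤ 3) :
    (∃ x y a b, P x y ≠ 0 ∧
      Submodule.span k (Set.range (P x)) ⊔ Submodule.span k {P a b} = ⊤) ∨
    (∃ x y a b, P x y ≠ 0 ∧
      Submodule.span k (Set.range fun x' => P x' y) ⊔ Submodule.span k {P a b} = ⊤) := by
  by_contra! hcon
  obtain ⟨hrow, hcol⟩ := hcon
  have hspan' : Submodule.span k (Set.range fun p : Y × X => P p.2 p.1) = ⊤ := by
    rw [← hspan]
    congr 1
    ext w
    exact ⟨fun ⟨p, hp⟩ => ⟨p.swap, hp⟩, fun ⟨p, hp⟩ => ⟨p.swap, hp⟩⟩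
  have hrow' : ∀ x y, P x y ≠ 0 →
      finrank k (Submodule.span k (Set.range (P x))) + 1 < finrank k W := by
    intro x y h
    by_contra! h'
    have : Nonempty Y := ⟨y⟩
    obtain ⟨a, b, hab⟩ := span_range_sup_span_singleton_eq_top P hspan x h'
    exact hrow x y a b h hab
  have hcol' : ∀ x y, P x y ≠ 0 →
      finrank k (Submodule.span k (Set.range fun x' => P x' y)) + 1 < finrank k W := by
    intro x y h
    by_contra! h'
    have : Nonempty X := ⟨x⟩
    obtain ⟨b, a, hab⟩ := span_range_sup_span_singleton_eq_top (fun y x => P x y) hspan' y h'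
    exact hcol x y a b h hab
  obtain ⟨f, hf, hfs, hfi⟩ := Submodule.exists_fun_fin_finrank_span_eq k
    (Set.range fun p : X × Y => P p.1 p.2)
  have hr : finrank k (Submodule.span k (Set.range fun p : X × Y => P p.1 p.2)) = finrank k W := by
    rw [hspan, finrank_top]
  have hposW : 0 < finrank k W := finrank_pos
  generalize finrank k (Submodule.span k (Set.range fun p : X × Y => P p.1 p.2)) = r at *
  have hpos : 0 < r := by omega
  choose p hp using hf
  have hne : ∀ i, P (p i).1 (p i).2 ≠ 0 := fun i => by
    have := hp i
    simp only at this
    rw [this]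
    exact hfi.ne_zero i
  have hmemrow : ∀ x y, P x y ∈ Submodule.span k (Set.range (P x)) :=
    fun x y => Submodule.subset_span ⟨y, rfl⟩
  have hmemcol : ∀ x y, P x y ∈ Submodule.span k (Set.range fun x' => P x' y) :=
    fun x y => Submodule.subset_span ⟨x, rfl⟩
  have hrow1 : 1 ≤ finrank k (Submodule.span k (Set.range (P (p ⟨0, hpos⟩).1))) := by
    rw [Submodule.one_le_finrank_iff]
    intro h
    have := hmemrow (p ⟨0, hpos⟩).1 (p ⟨0, hpos⟩).2
    rw [h, Submodule.mem_bot] at this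
    exact hne _ this
  have h3 := hrow' _ _ (hne ⟨0, hpos⟩)
  have h4 : 1 < r := by omega
  -- `P aᵢ bⱼ` lies on the lines spanned by `P aᵢ bᵢ` and by `P aⱼ bⱼ`.
  have hoff : ∀ i j, i ≠ j → P (p i).1 (p j).2 = 0 := by
    intro i j hij
    have hi := hrow' _ _ (hne i)
    have hj := hcol' _ _ (hne j)
    obtain ⟨c, hc⟩ := exists_smul_eq_of_finrank_lt_two (by omega) (hmemrow (p i).1 (p i).2)
      (hmemrow (p i).1 (p j).2) (hne i)
    obtain ⟨d, hd⟩ := exists_smul_eq_of_finrank_lt_two (by omega) (hmemcol (p j).1 (p j).2)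
      (hmemcol (p i).1 (p j).2) (hne j)
    have hp' : ∀ i, P (p i).1 (p i).2 = f i := hp
    rw [hp'] at hc hd
    have hpair := linearIndependent_pair_of_ne hfi hij
    have h0 := LinearIndependent.pair_iff.mp hpair c (-d) (by rw [neg_smul, hc, hd]; simp)
    rw [← hc, h0.1, zero_smul]
  set i0 : Fin r := ⟨0, hpos⟩
  set i1 : Fin r := ⟨1, h4⟩
  have h01 : i0 ≠ i1 := by simp [i0, i1]
  have hp' : ∀ i, P (p i).1 (p i).2 = f i := hp
  have hs0 : P ((p i0).1 + (p i1).1) (p i0).2 = f i0 := by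
    rw [hadd, hoff _ _ h01.symm, add_zero, hp']
  have hs1 : P ((p i0).1 + (p i1).1) (p i1).2 = f i1 := by
    rw [hadd, hoff _ _ h01, zero_add, hp']
  have hpair := linearIndependent_pair_of_ne hfi h01
  have h5 := two_le_finrank_of_linearIndependent_pair hpair
    (hs0 ▸ hmemrow ((p i0).1 + (p i1).1) (p i0).2) (hs1 ▸ hmemrow ((p i0).1 + (p i1).1) (p i1).2)
  have h6 := hrow' ((p i0).1 + (p i1).1) (p i0).2 (hs0 ▸ hfi.ne_zero i0)
  omega

/-! ### Indices of submodules, Nakayama's lemma and approximation -/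

namespace Submodule

variable {A M : Type*} [CommRing A] [AddCommGroup M] [Module A M]

/-- The index `[P : N ∩ P]` of one submodule in another, equal to `0` if it is infinite. -/
noncomputable def relCard (N P : Submodule A M) : ℕ :=
  N.toAddSubgroup.relIndex P.toAddSubgroup

theorem relCard_eq_card_map (N P : Submodule A M) : relCard N P = Nat.card (P.map N.mkQ) := by
  have := AddSubgroup.relIndex_ker P.toAddSubgroup N.mkQ.toAddMonoidHom
  rw [relCard]
  convert! this using 2
  ext x
  simp [AddMonoidHom.mem_ker]

theorem relCard_mul_cardQuot {N P : Submodule A M} (h : N ≤ P) :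
    relCard N P * cardQuot P = cardQuot N :=
  AddSubgroup.relIndex_mul_index h

theorem relCard_mul_relCard {N P Q : Submodule A M} (h : N ≤ P) (h' : P ≤ Q) :
    relCard N P * relCard P Q = relCard N Q :=
  AddSubgroup.relIndex_mul_relIndex _ _ _ h h'

theorem relCard_top (N : Submodule A M) : relCard N ⊤ = cardQuot N :=
  AddSubgroup.relIndex_top_right _

theorem relCard_pos {N P : Submodule A M} [Finite (M ⧸ N)] : 0 < relCard N P := by
  rw [relCard_eq_card_map]
  exact Nat.card_pos

theorem relCard_eq_one_iff {N P : Submodule A M} : relCard N P = 1 ↔ P ≤ N :=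
  AddSubgroup.relIndex_eq_one

theorem relCard_sup_right (N P : Submodule A M) : relCard N (N ⊔ P) = relCard N P := by
  unfold relCard
  rw [sup_toAddSubgroup, sup_comm]
  exact AddSubgroup.relIndex_sup_right _ _

theorem relCard_inf_right (N P : Submodule A M) : relCard (N ⊓ P) P = relCard N P :=
  AddSubgroup.inf_relIndex_right N.toAddSubgroup P.toAddSubgroup

theorem relCard_le_of_le_left {N N' P : Submodule A M} (h : N ≤ N') [Finite (M ⧸ N)] :
    relCard N' P ≤ relCard N P :=
  AddSubgroup.relIndex_le_of_le_left (toAddSubgroup_mono h) relCard_pos.ne'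

theorem relCard_le_of_le_right {N P P' : Submodule A M} (h : P ≤ P') [Finite (M ⧸ N)] :
    relCard N P ≤ relCard N P' :=
  AddSubgroup.relIndex_le_of_le_right (toAddSubgroup_mono h) relCard_pos.ne'

theorem relCard_map_of_injective {M' : Type*} [AddCommGroup M'] [Module A M'] (N P : Submodule A M)
    (f : M →ₗ[A] M') (hf : Function.Injective f) : relCard (N.map f) (P.map f) = relCard N P := by
  have h := AddSubgroup.relIndex_map_map_of_injective (f := (f : M →+ M')) N.toAddSubgroup
    P.toAddSubgroup hf
  rw [relCard, relCard, ← h, map_toAddSubgroup, map_toAddSubgroup]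

/-- If `P ≤ N + A p`, and every multiple of `q ∈ P'` in `N'` gives a multiple of `p` in `N`, then the
cyclic quotient `P / N` is no larger than `P' / N'`. -/
theorem relCard_le_relCard_of_cyclic {M' : Type*} [AddCommGroup M'] [Module A M']
    {N P : Submodule A M} {N' P' : Submodule A M'} [Finite (M' ⧸ N')] {p : M} {q : M'}
    (hP : P ≤ N ⊔ span A {p}) (hq : q ∈ P') (h : ∀ r : A, r • q ∈ N' → r • p ∈ N) :
    relCard N P ≤ relCard N' P' := by
  rw [relCard_eq_card_map, relCard_eq_card_map]
  have hex : ∀ y : P.map N.mkQ, ∃ r : A, N.mkQ (r • p) = y := by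
    rintro ⟨_, x, hx, rfl⟩
    obtain ⟨n, hn, z, hz, rfl⟩ := mem_sup.mp (hP hx)
    obtain ⟨r, rfl⟩ := mem_span_singleton.mp hz
    refine ⟨r, ?_⟩
    change N.mkQ (r • p) = N.mkQ (n + r • p)
    rw [map_add, N.mkQ_apply n, (Quotient.mk_eq_zero N).mpr hn, zero_add]
  choose r hr using hex
  refine Nat.card_le_card_of_injective
    (fun y => (⟨N'.mkQ (r y • q), mem_map_of_mem (P'.smul_mem _ hq)⟩ : P'.map N'.mkQ)) ?_
  intro y y' hyy'
  have h1 : N'.mkQ (r y • q) = N'.mkQ (r y' • q) := congrArg Subtype.val hyy'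
  have h2 : (r y - r y') • q ∈ N' := by
    rw [sub_smul]
    exact (Quotient.eq N').mp h1
  have h3 := h _ h2
  rw [sub_smul] at h3
  apply Subtype.ext
  rw [← hr, ← hr]
  exact (Quotient.eq N).mpr h3

/-- A form of Nakayama's lemma: an inclusion into `N` of a finitely generated module `P` with
`x P ≤ N` can be checked modulo the maximal ideals that contain `x`. -/
theorem le_of_forall_isMaximal_le_sup_smul {N P : Submodule A M} (hP : P.FG) (x : A)
    (hx : ∀ p ∈ P, x • p ∈ N)
    (h : ∀ n : Ideal A, n.IsMaximal → x ∈ n → P ≤ N ⊔ n • P) : P ≤ N := by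
  set Q : Submodule A (M ⧸ N) := P.map N.mkQ
  by_cases htop : Q.annihilator = ⊤
  · rw [annihilator_eq_top_iff] at htop
    have h0 : map N.mkQ P ≤ ⊥ := htop.le
    rwa [map_le_iff_le_comap, comap_bot, ker_mkQ] at h0
  · exfalso
    obtain ⟨n, hn, hle⟩ := Ideal.exists_le_maximal _ htop
    have hxn : x ∈ n := hle (mem_annihilator.mpr (by
      rintro _ ⟨p, hp, rfl⟩
      rw [← map_smul, mkQ_apply, Quotient.mk_eq_zero]
      exact hx p hp))
    have h1 : Q ≤ n • Q := by
      have h2 := Submodule.map_mono (f := N.mkQ) (h n hn hxn)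
      rwa [Submodule.map_sup, mkQ_map_self, bot_sup_eq, map_smul''] at h2
    obtain ⟨r, hr, hrQ⟩ := exists_sub_one_mem_and_smul_eq_zero_of_fg_of_le_smul n Q (hP.map _) h1
    have hrn : r ∈ n := hle (mem_annihilator.mpr hrQ)
    exact hn.ne_top (n.eq_top_iff_one.mpr (by simpa using n.sub_mem hrn hr))

/-- Chinese remainder theorem: elements of a module can be prescribed modulo `n M` for finitely many
maximal ideals `n`. -/
theorem exists_mem_forall_sub_mem_smul (T : Set (Ideal A)) (hT : T.Finite)
    (hmax : ∀ n ∈ T, n.IsMaximal) (P : Submodule A M) (a : Ideal A → M) (ha : ∀ n ∈ T, a n ∈ P) :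
    ∃ x ∈ P, ∀ n ∈ T, x - a n ∈ n • P := by
  classical
  have : Finite T := hT
  have : Fintype T := Fintype.ofFinite T
  have hcop : Pairwise (Function.onFun IsCoprime fun n : T => (n : Ideal A)) := by
    intro n n' hnn'
    have := hmax n n.2
    have := hmax n' n'.2
    exact Ideal.isCoprime_of_isMaximal fun h => hnn' (Subtype.ext h)
  have he : ∀ n : T, ∃ e : A, ∀ n' : T, e - (if n' = n then 1 else 0) ∈ (n' : Ideal A) := fun n =>
    Ideal.exists_forall_sub_mem_ideal hcop _
  choose e he using he
  refine ⟨∑ n, e n • a n, P.sum_mem fun n _ => P.smul_mem _ (ha n n.2), fun n hn => ?_⟩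
  have h1 : a n = ∑ n' : T, (if (⟨n, hn⟩ : T) = n' then (1 : A) else 0) • a n' := by
    simp [ite_smul]
  rw [h1, ← Finset.sum_sub_distrib]
  refine Submodule.sum_mem _ fun n' _ => ?_
  rw [← sub_smul]
  exact smul_mem_smul (he n' ⟨n, hn⟩) (ha n' n'.2)

/-- Generation of `M / mM` over the residue field means generation of `M` modulo `mM`. -/
theorem span_sup_smul_top_of_span_quotient_eq_top (m : Ideal A) (S : Set M)
    (h : span (A ⧸ m) ((m • ⊤ : Submodule A M).mkQ '' S) = ⊤) :
    span A S ⊔ m • ⊤ = ⊤ := by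
  have h1 := congrArg (restrictScalars A) h
  rw [restrictScalars_span A (A ⧸ m) Ideal.Quotient.mk_surjective, restrictScalars_top,
    span_image] at h1
  have h2 := congrArg (comap (m • ⊤ : Submodule A M).mkQ) h1
  rwa [comap_map_eq, ker_mkQ, comap_top] at h2

theorem span_quotient_eq_top_of_span_sup_smul_top (m : Ideal A) (S : Set M)
    (h : span A S ⊔ m • ⊤ = ⊤) :
    span (A ⧸ m) ((m • ⊤ : Submodule A M).mkQ '' S) = ⊤ := by
  apply restrictScalars_injective A
  rw [restrictScalars_span A (A ⧸ m) Ideal.Quotient.mk_surjective, restrictScalars_top,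
    span_image]
  have h1 := congrArg (map (m • ⊤ : Submodule A M).mkQ) h
  rwa [map_sup, mkQ_map_self, sup_bot_eq, map_top, range_mkQ] at h1

end Submodule

/-! ### Super-multiplicativity of rings whose ideals have three generators -/

section

variable {A : Type*} [CommRing A] [IsDomain A]

theorem cardQuot_span_singleton_mul {x : A} (hx : x ≠ 0) (J : Ideal A) :
    cardQuot (Ideal.span {x} * J) = cardQuot (Ideal.span {x}) * cardQuot J := by
  have h : relCard (Ideal.span {x} * J) (Ideal.span {x}) = cardQuot J := by
    have h' := relCard_map_of_injective J ⊤ (LinearMap.mulLeft A x) (mul_right_injective₀ hx)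
    rw [relCard_top] at h'
    rw [← h']
    congr 1
    · ext z
      simp [Ideal.mem_span_singleton_mul]
    · ext z
      simp [Ideal.mem_span_singleton', mul_comm]
  rw [← relCard_mul_cardQuot (Ideal.mul_le_left : Ideal.span {x} * J ≤ Ideal.span {x}), h, mul_comm]

/-- If `IJ = xJ + (ab)` with `x, a ∈ I` and `b ∈ J`, then `IJ / xJ` is no larger than `I / (x)`, and
the inequality follows from `N(xJ) = N((x)) N(J)`. -/
theorem cardQuot_mul_le_of_mul_le_sup [Ring.HasFiniteQuotients A] {I J : Ideal A} {x a b : A}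
    (hx : x ∈ I) (hx0 : x ≠ 0) (hJ : J ≠ ⊥) (ha : a ∈ I) (hb : b ∈ J)
    (h : I * J ≤ Ideal.span {x} * J ⊔ Ideal.span {a * b}) :
    cardQuot I * cardQuot J ≤ cardQuot (I * J) := by
  have hxne : Ideal.span {x} ≠ ⊥ := by simpa using hx0
  have hxI : Ideal.span {x} ≤ I := (Ideal.span_singleton_le_iff_mem I).mpr hx
  have hxJne : Ideal.span {x} * J ≠ ⊥ := mul_ne_zero hxne hJ
  have := Ring.HasFiniteQuotients.finiteQuotient hxne
  have := Ring.HasFiniteQuotients.finiteQuotient hxJne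
  have h1 := relCard_mul_cardQuot (Ideal.mul_mono_left hxI : Ideal.span {x} * J ≤ I * J)
  have h2 := relCard_mul_cardQuot hxI
  have h3 := cardQuot_span_singleton_mul hx0 J
  have h6 : relCard (Ideal.span {x} * J) (I * J) ≤ relCard (Ideal.span {x}) I := by
    refine relCard_le_relCard_of_cyclic h ha fun r hr => ?_
    obtain ⟨s, hs⟩ := Ideal.mem_span_singleton'.mp hr
    have : r • (a * b) = x * (s * b) := by
      rw [smul_eq_mul, ← mul_assoc, ← smul_eq_mul r a, ← hs]
      ring
    rw [this]
    exact Ideal.mul_mem_mul (Ideal.mem_span_singleton_self x) (J.mul_mem_left s hb)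
  have h7 : 0 < relCard (Ideal.span {x}) I := relCard_pos
  refine Nat.le_of_mul_le_mul_left ?_ h7
  calc relCard (Ideal.span {x}) I * (cardQuot I * cardQuot J)
      = cardQuot (Ideal.span {x}) * cardQuot J := by rw [← h2]; ring
    _ = relCard (Ideal.span {x} * J) (I * J) * cardQuot (I * J) := by rw [← h3, h1]
    _ ≤ _ := Nat.mul_le_mul_right _ h6

/-- It suffices that `xJ` and `ab` generate `IJ` modulo `m IJ` for the only maximal ideal `m`
containing `IJ`: the Chinese remainder theorem provides `a' ∈ I` and `b' ∈ J` that agree with `a` and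
`b` at `m` and have `a' b' ∉ n` at the other maximal ideals `n` containing `x`. -/
theorem cardQuot_mul_le_of_mul_le_sup_smul [Ring.HasFiniteQuotients A] {I J m : Ideal A} {x a b : A}
    (hm : ∀ n : Ideal A, n.IsMaximal → I * J ≤ n → n = m)
    (hx : x ∈ I) (hx0 : x ≠ 0) (hJ : J ≠ ⊥) (ha : a ∈ I) (hb : b ∈ J)
    (h : I * J ≤ Ideal.span {x} * J ⊔ Ideal.span {a * b} ⊔ m • (I * J)) :
    cardQuot I * cardQuot J ≤ cardQuot (I * J) := by
  classical
  let T : Set (Ideal A) := {n | n.IsMaximal ∧ x ∈ n}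
  have hT : T.Finite := (Ring.HasFiniteQuotients.finite_setOfPred_mem x hx0).subset
    fun n hn => hn.2
  have hselI : ∀ n : Ideal A, ∃ a, n.IsMaximal → n ≠ m → a ∈ I ∧ a ∉ n := by
    intro n
    by_cases h1 : I ≤ n
    · exact ⟨0, fun hn hnm => absurd (hm n hn (Ideal.mul_le_left.trans h1)) hnm⟩
    · obtain ⟨a, ha⟩ := SetLike.not_le_iff_exists.mp h1
      exact ⟨a, fun _ _ => ha⟩
  have hselJ : ∀ n : Ideal A, ∃ b, n.IsMaximal → n ≠ m → b ∈ J ∧ b ∉ n := by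
    intro n
    by_cases h1 : J ≤ n
    · exact ⟨0, fun hn hnm => absurd (hm n hn (Ideal.mul_le_right.trans h1)) hnm⟩
    · obtain ⟨b, hb⟩ := SetLike.not_le_iff_exists.mp h1
      exact ⟨b, fun _ _ => hb⟩
  choose f hf using hselI
  choose g hg using hselJ
  obtain ⟨a', ha', haT⟩ := exists_mem_forall_sub_mem_smul T hT (fun n hn => hn.1) I
    (fun n => if n = m then a else f n) (fun n hn => by
      split_ifs with hnm
      · exact ha
      · exact (hf n hn.1 hnm).1)
  obtain ⟨b', hb', hbT⟩ := exists_mem_forall_sub_mem_smul T hT (fun n hn => hn.1) J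
    (fun n => if n = m then b else g n) (fun n hn => by
      split_ifs with hnm
      · exact hb
      · exact (hg n hn.1 hnm).1)
  refine cardQuot_mul_le_of_mul_le_sup hx hx0 hJ ha' hb' ?_
  refine le_of_forall_isMaximal_le_sup_smul (IsNoetherian.noetherian _) x ?_ ?_
  · intro p hp
    exact mem_sup_left (Ideal.mul_mem_mul (Ideal.mem_span_singleton_self x)
      (Ideal.mul_le_right hp))
  · intro n hn hxn
    have haT' : a' - (if n = m then a else f n) ∈ n * I := haT n ⟨hn, hxn⟩
    have hbT' : b' - (if n = m then b else g n) ∈ n * J := hbT n ⟨hn, hxn⟩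
    by_cases hnm : n = m
    · subst hnm
      rw [if_pos rfl] at haT' hbT'
      have hab : a * b ∈ (Ideal.span {x} * J ⊔ Ideal.span {a' * b'}) ⊔ n * (I * J) := by
        have e : a * b = a' * b' - ((a' - a) * b' + a * (b' - b)) := by ring
        rw [e]
        refine sub_mem (mem_sup_left (mem_sup_right (Ideal.mem_span_singleton_self _)))
          (mem_sup_right (add_mem ?_ ?_))
        · rw [← mul_assoc]
          exact Ideal.mul_mem_mul haT' hb'
        · rw [mul_left_comm]
          exact Ideal.mul_mem_mul ha hbT'
      refine h.trans (sup_le (sup_le (le_sup_left.trans le_sup_left) ?_) le_sup_right)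
      exact (Ideal.span_singleton_le_iff_mem _).mpr hab
    · rw [if_neg hnm] at haT' hbT'
      have ha'n : a' ∉ n := fun hmem => (hf n hn hnm).2 (by
        simpa using n.sub_mem hmem (Ideal.mul_le_left haT'))
      have hb'n : b' ∉ n := fun hmem => (hg n hn hnm).2 (by
        simpa using n.sub_mem hmem (Ideal.mul_le_left hbT'))
      have hab : a' * b' ∉ n := fun hmem => (hn.isPrime.mem_or_mem hmem).elim ha'n hb'n
      obtain ⟨y, i, hi, hyi⟩ := hn.exists_inv hab
      intro p hp
      have e : p = p * y * (a' * b') + i * p := by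
        linear_combination (-p) * hyi
      rw [e]
      exact add_mem (mem_sup_left (mem_sup_right (Ideal.mul_mem_left _ _
        (Ideal.mem_span_singleton_self _)))) (mem_sup_right (smul_mem_smul hi hp))

/-- Modulo a maximal ideal `m`, a product of ideals with three generators is generated by a multiple
of one of the factors together with one further product. -/
theorem exists_mul_le_sup_smul_of_eq_span [IsNoetherianRing A] {I J m : Ideal A} [m.IsMaximal]
    (hIJ : I * J ≠ ⊥) {g₁ g₂ g₃ : A} (h3 : I * J = Ideal.span {g₁, g₂, g₃}) :
    (∃ x ∈ I, ∃ a ∈ I, ∃ b ∈ J, x ≠ 0 ∧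
      I * J ≤ Ideal.span {x} * J ⊔ Ideal.span {a * b} ⊔ m • (I * J)) ∨
    (∃ y ∈ J, ∃ a ∈ I, ∃ b ∈ J, y ≠ 0 ∧
      I * J ≤ Ideal.span {y} * I ⊔ Ideal.span {a * b} ⊔ m • (I * J)) := by
  let : Field (A ⧸ m) := Ideal.Quotient.field m
  let L : Ideal A := I * J
  let mL : Submodule A L := m • ⊤
  let W := L ⧸ mL
  let P' : I → J → L := fun a b => ⟨a * b, Ideal.mul_mem_mul a.2 b.2⟩
  let P : I → J → W := fun a b => mL.mkQ (P' a b)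
  have hW : Nontrivial W := by
    rw [Submodule.Quotient.nontrivial_iff]
    intro htop
    obtain ⟨r, hr, hr0⟩ := exists_sub_one_mem_and_smul_eq_zero_of_fg_of_le_smul m
      (⊤ : Submodule A L) (IsNoetherian.noetherian _) htop.ge
    obtain ⟨z, hz, hz0⟩ := exists_mem_ne_zero_of_ne_bot hIJ
    have h1 := congrArg Subtype.val (hr0 ⟨z, hz⟩ trivial)
    have h2 : r * z = 0 := h1
    have h3 : r = 0 := (mul_eq_zero.mp h2).resolve_right hz0
    rw [h3, zero_sub] at hr
    exact (Ideal.IsMaximal.ne_top ‹_›) (m.eq_top_iff_one.mpr (by simpa using m.neg_mem hr))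
  have hspan' : span A (Set.range fun p : I × J => P' p.1 p.2) = ⊤ := by
    apply map_injective_of_injective L.injective_subtype
    rw [map_span, ← Set.range_comp, Submodule.map_top, range_subtype]
    refine le_antisymm (span_le.mpr ?_) (Ideal.mul_le.mpr fun a ha b hb => subset_span
      ⟨(⟨a, ha⟩, ⟨b, hb⟩), rfl⟩)
    rintro _ ⟨p, rfl⟩
    exact (P' p.1 p.2).2
  have hspan : span (A ⧸ m) (Set.range fun p : I × J => P p.1 p.2) = ⊤ := by
    have := span_quotient_eq_top_of_span_sup_smul_top m _
      (by rw [hspan', top_sup_eq] : span A (Set.range fun p : I × J => P' p.1 p.2) ⊔ m • ⊤ = ⊤)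
    rwa [← Set.range_comp] at this
  have hg : ∀ g ∈ ({g₁, g₂, g₃} : Set A), g ∈ L := fun g hg => by
    have := Ideal.subset_span hg
    rwa [← h3] at this
  let G : Set L := {⟨g₁, hg g₁ (by simp)⟩, ⟨g₂, hg g₂ (by simp)⟩, ⟨g₃, hg g₃ (by simp)⟩}
  have hG : span A G = ⊤ := by
    apply map_injective_of_injective L.injective_subtype
    rw [map_span, Submodule.map_top, range_subtype]
    simp only [G, Set.image_insert_eq, Set.image_singleton, subtype_apply]
    exact h3.symm
  have hGW : span (A ⧸ m) (mL.mkQ '' G) = ⊤ :=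
    span_quotient_eq_top_of_span_sup_smul_top m _ (by rw [hG, top_sup_eq])
  have hGfin : (mL.mkQ '' G).Finite := (Set.toFinite G).image _
  have hWfin : FiniteDimensional (A ⧸ m) W := ⟨⟨hGfin.toFinset, by simpa using hGW⟩⟩
  have hdim : finrank (A ⧸ m) W ≤ 3 := by
    classical
    have h1 := finrank_span_finset_le_card (R := A ⧸ m)
      ({mL.mkQ ⟨g₁, hg g₁ (by simp)⟩, mL.mkQ ⟨g₂, hg g₂ (by simp)⟩,
        mL.mkQ ⟨g₃, hg g₃ (by simp)⟩} : Finset W)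
    have h2 : (mL.mkQ '' G) = (({mL.mkQ ⟨g₁, hg g₁ (by simp)⟩, mL.mkQ ⟨g₂, hg g₂ (by simp)⟩,
        mL.mkQ ⟨g₃, hg g₃ (by simp)⟩} : Finset W) : Set W) := by
      simp [G, Set.image_insert_eq]
    rw [Set.finrank, ← h2, hGW, finrank_top] at h1
    exact h1.trans Finset.card_le_three
  -- Translation of a spanning statement in `W` back to ideals of `A`.
  have key : ∀ (S : Set L) (a : I) (b : J) (N : Ideal A), (∀ s ∈ S, (s : A) ∈ N) →
      span (A ⧸ m) (mL.mkQ '' S) ⊔ span (A ⧸ m) {P a b} = ⊤ →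
      I * J ≤ N ⊔ Ideal.span {(a : A) * b} ⊔ m • (I * J) := by
    intro S a b N hS htop
    have h1 : span (A ⧸ m) (mL.mkQ '' (S ∪ {P' a b})) = ⊤ := by
      rw [Set.image_union, span_union, Set.image_singleton]
      exact htop
    have h2 := span_sup_smul_top_of_span_quotient_eq_top m _ h1
    have h3 := congrArg (map L.subtype) h2
    rw [Submodule.map_sup, Submodule.map_top, range_subtype, map_smul'', Submodule.map_top,
      range_subtype, map_span] at h3
    refine h3.ge.trans (sup_le_sup_right (span_le.mpr ?_) _)
    rintro _ ⟨s, hs | hs, rfl⟩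
    · exact mem_sup_left (hS s hs)
    · rw [Set.mem_singleton_iff] at hs
      subst hs
      exact mem_sup_right (Ideal.mem_span_singleton_self _)
  have hP0 : ∀ x y, P x y ≠ 0 → (x : A) ≠ 0 ∧ (y : A) ≠ 0 := by
    intro x y hxy
    constructor <;> intro h0 <;> apply hxy
    · have : P' x y = 0 := Subtype.ext (by simp [P', h0])
      simp only [P, this, map_zero]
    · have : P' x y = 0 := Subtype.ext (by simp [P', h0])
      simp only [P, this, map_zero]
  rcases exists_row_or_column_sup_span_singleton_eq_top (k := A ⧸ m) P (fun x x' y => by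
      simp only [P]
      rw [← map_add]
      congr 1
      exact Subtype.ext (add_mul _ _ _)) hspan hdim with
    ⟨x, y, a, b, hxy, htop⟩ | ⟨x, y, a, b, hxy, htop⟩
  · refine Or.inl ⟨x, x.2, a, a.2, b, b.2, (hP0 x y hxy).1, ?_⟩
    refine key (Set.range (P' x)) a b _ ?_ (by rw [← Set.range_comp]; exact htop)
    rintro _ ⟨z, rfl⟩
    exact Ideal.mul_mem_mul (Ideal.mem_span_singleton_self _) z.2
  · refine Or.inr ⟨y, y.2, a, a.2, b, b.2, (hP0 x y hxy).2, ?_⟩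
    refine key (Set.range fun z => P' z y) a b _ ?_ (by rw [← Set.range_comp]; exact htop)
    rintro _ ⟨z, rfl⟩
    rw [mul_comm (Ideal.span _)]
    exact Ideal.mul_mem_mul z.2 (Ideal.mem_span_singleton_self _)

/-- Super-multiplicativity for a product contained in at most one maximal ideal. -/
theorem cardQuot_mul_le_of_unique_isMaximal [Ring.HasFiniteQuotients A] {I J m : Ideal A}
    [m.IsMaximal] (hm : ∀ n : Ideal A, n.IsMaximal → I * J ≤ n → n = m) (hIJ : I * J ≠ ⊥)
    {g₁ g₂ g₃ : A} (h3 : I * J = Ideal.span {g₁, g₂, g₃}) :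
    cardQuot I * cardQuot J ≤ cardQuot (I * J) := by
  have hI : I ≠ ⊥ := by rintro rfl; simp at hIJ
  have hJ : J ≠ ⊥ := by rintro rfl; simp at hIJ
  rcases exists_mul_le_sup_smul_of_eq_span (m := m) hIJ h3 with
    ⟨x, hx, a, ha, b, hb, hx0, h⟩ | ⟨y, hy, a, ha, b, hb, hy0, h⟩
  · exact cardQuot_mul_le_of_mul_le_sup_smul hm hx hx0 hJ ha hb h
  · rw [mul_comm I J] at hm h
    rw [mul_comm, mul_comm I J]
    rw [mul_comm a b] at h
    exact cardQuot_mul_le_of_mul_le_sup_smul hm hy hy0 hI hb ha h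

/-- A nonzero ideal contained in two distinct maximal ideals contains a product of two proper
coprime ideals that contain it: the `m`-primary part and its complement. -/
theorem exists_isCoprime_mul_le {A : Type*} [CommRing A] [Ring.HasFiniteQuotients A] {L m n : Ideal A} (hL : L ≠ ⊥)
    [hm : m.IsMaximal] [hn : n.IsMaximal] (hmn : m ≠ n) (hLm : L ≤ m) (hLn : L ≤ n) :
    ∃ P Q : Ideal A, L ≤ P ∧ L ≤ Q ∧ P ≠ ⊤ ∧ Q ≠ ⊤ ∧ IsCoprime P Q ∧ P * Q ≤ L := by
  have := Ring.HasFiniteQuotients.finiteQuotient hL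
  have hart : IsArtinian A (A ⧸ L) := inferInstance
  -- The powers of `m` become stationary modulo `L`, and Nakayama's lemma gives `r ≡ 1` modulo `m`
  -- that annihilates the stationary power.
  obtain ⟨k, hk⟩ := IsArtinian.monotone_stabilizes (R := A) (M := A ⧸ L)
    ⟨fun k => OrderDual.toDual (map L.mkQ (m ^ k)), fun i j hij =>
      OrderDual.toDual_le_toDual.mpr (map_mono (Ideal.pow_le_pow_right hij))⟩
  have hk1 : map L.mkQ (m ^ (k + 1)) = map L.mkQ (m ^ (k + 2)) :=
    (hk (k + 1) (by omega)).symm.trans (hk (k + 2) (by omega))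
  have hk2 : map L.mkQ (m ^ (k + 1)) ≤ m • map L.mkQ (m ^ (k + 1)) := by
    rw [← map_smul'', smul_eq_mul, ← pow_succ', ← hk1]
  obtain ⟨r, hr, hr0⟩ := exists_sub_one_mem_and_smul_eq_zero_of_fg_of_le_smul m _
    (IsNoetherian.noetherian _) hk2
  have hrL : ∀ z ∈ m ^ (k + 1), r * z ∈ L := fun z hz => by
    have := hr0 _ (mem_map_of_mem hz)
    rwa [← map_smul, mkQ_apply, Quotient.mk_eq_zero] at this
  refine ⟨m ^ (k + 1) ⊔ L, Ideal.span {r} ⊔ L, le_sup_right, le_sup_right, ?_, ?_, ?_, ?_⟩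
  · intro h
    have : m ^ (k + 1) ⊔ L ≤ m := sup_le (Ideal.pow_le_self (by omega)) hLm
    exact hm.ne_top (top_le_iff.mp (h ▸ this))
  · intro h
    have hrn : r ∈ n := by
      by_contra hrn
      apply hmn
      refine hm.eq_of_le hn.ne_top ?_
      intro z hz
      have h1 : r * z ^ (k + 1) ∈ n := hLn (hrL _ (Ideal.pow_mem_pow hz _))
      exact hn.isPrime.mem_of_pow_mem _ ((hn.isPrime.mem_or_mem h1).resolve_left hrn)
    have : Ideal.span {r} ⊔ L ≤ n := sup_le ((Ideal.span_singleton_le_iff_mem n).mpr hrn) hLn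
    exact hn.ne_top (top_le_iff.mp (h ▸ this))
  · have h1 : IsCoprime m (Ideal.span {r}) := by
      rw [Ideal.isCoprime_iff_exists]
      exact ⟨-(r - 1), m.neg_mem hr, r, Ideal.mem_span_singleton_self r, by ring⟩
    have h2 : IsCoprime (m ^ (k + 1)) (Ideal.span {r}) := h1.pow_left
    rw [Ideal.isCoprime_iff_sup_eq] at h2 ⊢
    rw [eq_top_iff, ← h2]
    exact sup_le_sup le_sup_left le_sup_left
  · rw [Ideal.sup_mul, Ideal.mul_sup]
    refine sup_le (sup_le ?_ Ideal.mul_le_right) Ideal.mul_le_left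
    rw [mul_comm]
    rw [Ideal.span_singleton_mul_le_iff]
    exact hrL

theorem sup_mul_sup_eq_of_mul_le {A : Type*} [CommRing A] {I P Q : Ideal A} (hcop : IsCoprime P Q) (h : P * Q ≤ I) :
    (I ⊔ P) * (I ⊔ Q) = I := by
  refine le_antisymm ?_ ?_
  · rw [Ideal.sup_mul, Ideal.mul_sup, Ideal.mul_sup]
    exact sup_le (sup_le Ideal.mul_le_left Ideal.mul_le_left) (sup_le Ideal.mul_le_right h)
  · have h1 : IsCoprime (I ⊔ P) (I ⊔ Q) := by
      rw [Ideal.isCoprime_iff_sup_eq] at hcop ⊢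
      rw [eq_top_iff, ← hcop]
      exact sup_le_sup le_sup_right le_sup_right
    rw [Ideal.mul_eq_inf_of_isCoprime h1]
    exact le_inf le_sup_left le_sup_left

/-- A domain with finite quotients whose ideals are generated by three elements is
super-multiplicative. -/
theorem cardQuot_mul_le_of_forall_eq_span [Ring.HasFiniteQuotients A]
    (h3 : ∀ I : Ideal A, ∃ g₁ g₂ g₃ : A, I = Ideal.span {g₁, g₂, g₃}) (I J : Ideal A)
    (hIJ : I * J ≠ ⊥) : cardQuot I * cardQuot J ≤ cardQuot (I * J) := by
  induction hN : cardQuot (I * J) using Nat.strong_induction_on generalizing I J with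
  | _ N ih =>
  subst hN
  by_cases hex : ∃ m n : Ideal A, m.IsMaximal ∧ n.IsMaximal ∧ m ≠ n ∧ I * J ≤ m ∧ I * J ≤ n
  · obtain ⟨m, n, hm, hn, hmn, hLm, hLn⟩ := hex
    obtain ⟨P, Q, hP, hQ, hPt, hQt, hcop, hPQ⟩ := exists_isCoprime_mul_le hIJ hmn hLm hLn
    have hI : (I ⊔ P) * (I ⊔ Q) = I := sup_mul_sup_eq_of_mul_le hcop (hPQ.trans Ideal.mul_le_left)
    have hJ : (J ⊔ P) * (J ⊔ Q) = J := sup_mul_sup_eq_of_mul_le hcop (hPQ.trans Ideal.mul_le_right)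
    have hc : ∀ X Y : Ideal A, P ≤ X → Q ≤ Y → IsCoprime X Y := by
      intro X Y hX hY
      rw [Ideal.isCoprime_iff_sup_eq] at hcop ⊢
      rw [eq_top_iff, ← hcop]
      exact sup_le_sup hX hY
    have hcI := hc (I ⊔ P) (I ⊔ Q) le_sup_right le_sup_right
    have hcJ := hc (J ⊔ P) (J ⊔ Q) le_sup_right le_sup_right
    have hcL : IsCoprime ((I ⊔ P) * (J ⊔ P)) ((I ⊔ Q) * (J ⊔ Q)) :=
      IsCoprime.mul_left (IsCoprime.mul_right hcI (hc _ _ le_sup_right le_sup_right))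
        (IsCoprime.mul_right (hc _ _ le_sup_right le_sup_right) hcJ)
    have hL : ((I ⊔ P) * (J ⊔ P)) * ((I ⊔ Q) * (J ⊔ Q)) = I * J := by
      rw [mul_mul_mul_comm, hI, hJ]
    have hNL := cardQuot_mul_of_coprime hcL
    rw [hL] at hNL
    have hNI := cardQuot_mul_of_coprime hcI
    rw [hI] at hNI
    have hNJ := cardQuot_mul_of_coprime hcJ
    rw [hJ] at hNJ
    have hne : (I ⊔ P) * (J ⊔ P) ≠ ⊥ ∧ (I ⊔ Q) * (J ⊔ Q) ≠ ⊥ := by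
      constructor <;> intro h0 <;> rw [h0] at hL <;> apply hIJ <;> rw [← hL] <;> simp
    have hpos1 := Ring.HasFiniteQuotients.cardQuot_pos _ hne.1
    have hpos2 := Ring.HasFiniteQuotients.cardQuot_pos _ hne.2
    have hIJP : (I ⊔ P) * (J ⊔ P) ≤ P := by
      rw [Ideal.sup_mul, Ideal.mul_sup]
      exact sup_le (sup_le hP Ideal.mul_le_right) Ideal.mul_le_left
    have hIJQ : (I ⊔ Q) * (J ⊔ Q) ≤ Q := by
      rw [Ideal.sup_mul, Ideal.mul_sup]
      exact sup_le (sup_le hQ Ideal.mul_le_right) Ideal.mul_le_left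
    have hne1 : cardQuot ((I ⊔ P) * (J ⊔ P)) ≠ 1 := fun h =>
      hPt (top_le_iff.mp ((cardQuot_eq_one_iff.mp h) ▸ hIJP))
    have hne2 : cardQuot ((I ⊔ Q) * (J ⊔ Q)) ≠ 1 := fun h =>
      hQt (top_le_iff.mp ((cardQuot_eq_one_iff.mp h) ▸ hIJQ))
    have h1 := ih _ (by rw [hNL]; exact lt_mul_of_one_lt_right hpos1 (by omega))
      (I ⊔ P) (J ⊔ P) hne.1 rfl
    have h2 := ih _ (by rw [hNL]; exact lt_mul_of_one_lt_left hpos2 (by omega))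
      (I ⊔ Q) (J ⊔ Q) hne.2 rfl
    rw [hNL, hNI, hNJ]
    calc _ = (cardQuot (I ⊔ P) * cardQuot (J ⊔ P)) * (cardQuot (I ⊔ Q) * cardQuot (J ⊔ Q)) := by
          ring
      _ ≤ _ := Nat.mul_le_mul h1 h2
  · push Not at hex
    obtain ⟨g₁, g₂, g₃, hg⟩ := h3 (I * J)
    by_cases htop : I * J = ⊤
    · obtain ⟨m, hm⟩ := Ideal.exists_maximal A
      exact cardQuot_mul_le_of_unique_isMaximal (m := m)
        (fun n hn hle => absurd (top_le_iff.mp (htop ▸ hle)) hn.ne_top) hIJ hg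
    · obtain ⟨m, hm, hLm⟩ := Ideal.exists_le_maximal _ htop
      refine cardQuot_mul_le_of_unique_isMaximal (m := m) (fun n hn hle => ?_) hIJ hg
      by_contra hnm
      exact hex n m hn hm hnm hle hLm

end

/-! ### Overrings of rings whose ideals have three generators -/

/-- Generators of an ideal of an overring of `R`, multiplied by a common denominator, generate an
ideal of `R`, and generators of the latter yield generators of the original ideal. -/
theorem exists_eq_span_of_overring {R F : Type*} [CommRing R] [Field F] [Algebra R F]
    [IsFractionRing R F] (h : ∀ I : Ideal R, ∃ a b c : R, I = Ideal.span {a, b, c})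
    (R' : Subalgebra R F) (L : Ideal R') (hL : L.FG) :
    ∃ a b c : R', L = Ideal.span {a, b, c} := by
  classical
  have : IsDomain R := (IsFractionRing.injective R F).isDomain (algebraMap R F)
  obtain ⟨t, ht⟩ := hL
  obtain ⟨s, hs⟩ := IsLocalization.exist_integer_multiples_of_finset R⁰
    (t.image (Subtype.val : R' → F))
  have hs0 : algebraMap R F s ≠ 0 := IsFractionRing.to_map_ne_zero_of_mem_nonZeroDivisors s.2
  let φ : R' →ₗ[R] F := (s : R) • R'.val.toLinearMap
  have hφ : ∀ l : R', φ l = algebraMap R F s * l := fun l => Algebra.smul_def _ _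
  let J : Ideal R := ((L.restrictScalars R).map φ).comap (Algebra.linearMap R F)
  obtain ⟨a, b, c, hJ⟩ := h J
  have hmem : ∀ g ∈ ({a, b, c} : Set R), ∃ l ∈ L, φ l = algebraMap R F g := by
    intro g hg
    have h1 : g ∈ J := hJ ▸ Ideal.subset_span hg
    obtain ⟨l, hl, hlg⟩ := h1
    exact ⟨l, hl, hlg⟩
  obtain ⟨a', ha', haa⟩ := hmem a (by simp)
  obtain ⟨b', hb', hbb⟩ := hmem b (by simp)
  obtain ⟨c', hc', hcc⟩ := hmem c (by simp)
  refine ⟨a', b', c', le_antisymm ?_ ?_⟩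
  · rw [← ht]
    refine Ideal.span_le.mpr fun l hl => ?_
    obtain ⟨r, hr⟩ := hs (l : F) (Finset.mem_image_of_mem _ hl)
    have hrJ : r ∈ J := ⟨l, ht ▸ Ideal.subset_span hl, hr.symm⟩
    rw [hJ] at hrJ
    obtain ⟨x, y, z, hxyz⟩ := mem_span_triple.mp hrJ
    refine mem_span_triple.mpr ⟨algebraMap R R' x, algebraMap R R' y, algebraMap R R' z, ?_⟩
    have h2 : algebraMap R F s * l = algebraMap R F r := hr.symm ▸ (Algebra.smul_def _ _).symm
    rw [hφ] at haa hbb hcc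
    apply Subtype.ext
    apply mul_left_cancel₀ hs0
    rw [h2, ← hxyz]
    simp only [smul_eq_mul, map_add, map_mul, ← haa, ← hbb, ← hcc]
    change algebraMap R F s * (algebraMap R F x * a' + algebraMap R F y * b' +
      algebraMap R F z * c') = _
    ring
  · refine Ideal.span_le.mpr ?_
    rintro _ (rfl | rfl | rfl)
    exacts [ha', hb', hc']

theorem numberField_of_injective {F K : Type*} [Field F] [Field K] [NumberField K] (f : F →+* K) :
    NumberField F := by
  have : CharZero F := (RingHom.charZero_iff f.injective).mpr inferInstance
  have : FiniteDimensional ℚ F :=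
    FiniteDimensional.of_injective (f.toRatAlgHom).toLinearMap f.injective
  exact { }

theorem isSuperMultiplicative_of_forall_eq_span {A : Type*} [CommRing A] [IsDomain A] [Infinite A]
    [Ring.HasFiniteQuotients A] (h3 : ∀ I : Ideal A, ∃ a b c : A, I = Ideal.span {a, b, c}) :
    IsSuperMultiplicative A := by
  intro I J hfin
  refine cardQuot_mul_le_of_forall_eq_span h3 I J fun h0 => ?_
  rw [h0] at hfin
  have : cardQuot (⊥ : Ideal A) = 0 := cardQuot_bot A A
  exact hfin.index_ne_zero this

/-! ### Linearly independent products in an algebra -/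

section

variable {k B : Type*} [Field k] [CommRing B] [Algebra k B]

/-- If `B` has dimension at least four and `a * b` always lies in the span of `1, a, b`, then multiplication by `a` is scalar modulo
the span of `1` and `a`. -/
theorem exists_sub_mul_mem_span_pair
    (h4 : ∀ a b : B, span k {1, a, b} ≠ ⊤)
    (H : ∀ a b : B, a ∉ span k {1} → b ∉ span k {1, a} → a * b ∈ span k {1, a, b})
    {a : B} (ha : a ∉ span k {(1 : B)}) :
    ∃ l : k, ∀ d : B, (a - algebraMap k B l) * d ∈ span k {1, a} := by
  have hex : ∀ b : B, ∃ c, c ∉ span k {1, a, b} := fun b => by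
    by_contra! h
    exact h4 a b (eq_top_iff.mpr fun c _ => h c)
  obtain ⟨b, hb'⟩ := hex a
  have hb : b ∉ span k {1, a} := by simpa using hb'
  obtain ⟨r, s, l, hl⟩ := mem_span_triple.mp (H a b ha hb)
  have key : ∀ c, c ∉ span k {1, a, b} → (a - algebraMap k B l) * c ∈ span k {1, a} := by
    intro c hc
    have hc1 : c ∉ span k {1, a} := fun h => hc (span_mono (by
      intro x hx; simp only [Set.mem_insert_iff, Set.mem_singleton_iff] at hx ⊢; tauto) h)
    have hbc : b + c ∉ span k {1, a} := by
      intro h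
      obtain ⟨x, y, hxy⟩ := mem_span_pair.mp h
      exact hc (mem_span_triple.mpr ⟨x, y, -1, by
        rw [neg_one_smul]; linear_combination hxy⟩)
    obtain ⟨r', s', t', h1⟩ := mem_span_triple.mp (H a c ha hc1)
    obtain ⟨r'', s'', t'', h2⟩ := mem_span_triple.mp (H a (b + c) ha hbc)
    -- Comparison of `a * b + a * c` with `a * (b + c)`.
    have e : (r + r' - r'') • (1 : B) + (s + s' - s'') • a + (l - t'') • b + (t' - t'') • c = 0 := by
      simp only [Algebra.smul_def, map_add, map_sub] at hl h1 h2 ⊢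
      linear_combination hl + h1 - h2
    have ht : t' = t'' := by
      by_contra hne
      have hne' : t' - t'' ≠ 0 := sub_ne_zero.mpr hne
      refine hc (mem_span_triple.mpr ⟨-(t' - t'')⁻¹ * (r + r' - r''), -(t' - t'')⁻¹ * (s + s' - s''),
        -(t' - t'')⁻¹ * (l - t''), ?_⟩)
      have e2 := congrArg (fun z => (t' - t'')⁻¹ • z) e
      simp only [smul_add, smul_smul, inv_mul_cancel₀ hne', one_smul, smul_zero] at e2
      simp only [neg_mul, neg_smul]
      linear_combination (-1 : B) * e2
    have hl' : l = t'' := by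
      by_contra hne
      have hne' : l - t'' ≠ 0 := sub_ne_zero.mpr hne
      refine hb (mem_span_pair.mpr ⟨-(l - t'')⁻¹ * (r + r' - r''), -(l - t'')⁻¹ * (s + s' - s''), ?_⟩)
      rw [ht, sub_self, zero_smul, add_zero] at e
      have e2 := congrArg (fun z => (l - t'')⁻¹ • z) e
      simp only [smul_add, smul_smul, inv_mul_cancel₀ hne', one_smul, smul_zero] at e2
      simp only [neg_mul, neg_smul]
      linear_combination (-1 : B) * e2
    refine mem_span_pair.mpr ⟨r', s', ?_⟩
    rw [ht, ← hl', Algebra.smul_def l] at h1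
    linear_combination h1
  refine ⟨l, fun d => ?_⟩
  by_cases hd : d ∈ span k {1, a, b}
  · obtain ⟨c, hc⟩ := hex b
    have hcd : c + d ∉ span k {1, a, b} := fun h => hc (by simpa using sub_mem h hd)
    have := sub_mem (key _ hcd) (key _ hc)
    rwa [← mul_sub, add_sub_cancel_left] at this
  · exact key d hd

/-- Under the hypotheses of `exists_sub_mul_mem_span_pair` every element is a scalar plus an eigenvector for
all multiplications. -/
theorem exists_forall_sub_mul_eq_smul
    (h4 : ∀ a b : B, span k {1, a, b} ≠ ⊤)
    (H : ∀ a b : B, a ∉ span k {1} → b ∉ span k {1, a} → a * b ∈ span k {1, a, b})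
    {a : B} (ha : a ∉ span k {(1 : B)}) :
    ∃ l : k, ∀ d : B, ∃ s : k, (a - algebraMap k B l) * d = s • (a - algebraMap k B l) := by
  obtain ⟨l, hl⟩ := exists_sub_mul_mem_span_pair h4 H ha
  refine ⟨l, fun d => ?_⟩
  obtain ⟨r, s, hrs⟩ := mem_span_pair.mp (hl d)
  refine ⟨s, ?_⟩
  set r' : k := r + s * l
  have e : (a - algebraMap k B l) * (d - algebraMap k B s) = algebraMap k B r' := by
    simp only [Algebra.smul_def, r', map_add, map_mul] at hrs ⊢
    linear_combination -hrs
  have hr0 : r' = 0 := by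
    -- Otherwise `a - l` is a unit that maps `B` into the span of `1` and `a`.
    by_contra hne
    apply h4 a a
    rw [eq_top_iff]
    intro x _
    have h1 := hl ((d - algebraMap k B s) * (algebraMap k B r'⁻¹ * x))
    rw [← mul_assoc, e, ← mul_assoc, ← map_mul, mul_inv_cancel₀ hne, map_one, one_mul] at h1
    simpa using h1
  rw [hr0, map_zero] at e
  rw [Algebra.smul_def]
  linear_combination e

/-- In an algebra of dimension at least four over a field in which ideals with two generators are
principal, some `1, a, b, a * b` are linearly independent. Otherwise `B` would be spanned by `1` and
eigenvectors `n₁, n₂, n₃, …` for all multiplications, having pairwise products zero and the same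
eigencharacter, and the ideal generated by `n₁` and `n₂` would not be principal. -/
theorem exists_mul_notMem_span
    (h4 : ∀ a b : B, span k {1, a, b} ≠ ⊤)
    (hprin : ∀ x y : B, ∃ d, Ideal.span {x, y} = Ideal.span {d}) :
    ∃ a b : B, a ∉ span k {1} ∧ b ∉ span k {1, a} ∧ a * b ∉ span k {1, a, b} := by
  by_contra! H
  have hex : ∀ a b : B, ∃ c, c ∉ span k {1, a, b} := fun a b => by
    by_contra! h
    exact h4 a b (eq_top_iff.mpr fun c _ => h c)
  obtain ⟨a, ha'⟩ := hex 1 1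
  have ha : a ∉ span k {(1 : B)} := by simpa using ha'
  obtain ⟨b, hb'⟩ := hex a a
  have hb : b ∉ span k {1, a} := by simpa using hb'
  obtain ⟨c, hc⟩ := hex a b
  have hb1 : b ∉ span k {(1 : B)} := fun h => hb (span_mono (by simp) h)
  have hc1 : c ∉ span k {(1 : B)} := fun h => hc (span_mono (by simp) h)
  obtain ⟨l₁, h₁⟩ := exists_forall_sub_mul_eq_smul h4 H ha
  obtain ⟨l₂, h₂⟩ := exists_forall_sub_mul_eq_smul h4 H hb1
  obtain ⟨l₃, h₃⟩ := exists_forall_sub_mul_eq_smul h4 H hc1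
  have hind : ∀ α β γ δ : k, α • (1 : B) + β • a + γ • b + δ • c = 0 →
      α = 0 ∧ β = 0 ∧ γ = 0 ∧ δ = 0 := by
    intro α β γ δ e
    have hone : (1 : B) ≠ 0 := fun h01 => ha (by
      rw [show a = 0 by rw [← mul_one a, h01, mul_zero]]; exact zero_mem _)
    have hδ : δ = 0 := by
      by_contra hne
      refine hc (mem_span_triple.mpr ⟨-δ⁻¹ * α, -δ⁻¹ * β, -δ⁻¹ * γ, ?_⟩)
      have e2 := congrArg (fun z => δ⁻¹ • z) e
      simp only [smul_add, smul_smul, inv_mul_cancel₀ hne, one_smul, smul_zero] at e2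
      simp only [neg_mul, neg_smul]
      linear_combination (-1 : B) * e2
    rw [hδ, zero_smul, add_zero] at e
    have hγ : γ = 0 := by
      by_contra hne
      refine hb (mem_span_pair.mpr ⟨-γ⁻¹ * α, -γ⁻¹ * β, ?_⟩)
      have e2 := congrArg (fun z => γ⁻¹ • z) e
      simp only [smul_add, smul_smul, inv_mul_cancel₀ hne, one_smul, smul_zero] at e2
      simp only [neg_mul, neg_smul]
      linear_combination (-1 : B) * e2
    rw [hγ, zero_smul, add_zero] at e
    have hβ : β = 0 := by
      by_contra hne
      refine ha (mem_span_singleton.mpr ⟨-β⁻¹ * α, ?_⟩)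
      have e2 := congrArg (fun z => β⁻¹ • z) e
      simp only [smul_add, smul_smul, inv_mul_cancel₀ hne, one_smul, smul_zero] at e2
      simp only [neg_mul, neg_smul]
      linear_combination (-1 : B) * e2
    rw [hβ, zero_smul, add_zero] at e
    exact ⟨(smul_eq_zero.mp e).resolve_right hone, hβ, hγ, hδ⟩
  set n₁ := a - algebraMap k B l₁ with hn₁
  set n₂ := b - algebraMap k B l₂ with hn₂
  set n₃ := c - algebraMap k B l₃ with hn₃
  have hind' : ∀ α β γ δ : k, α • (1 : B) + β • n₁ + γ • n₂ + δ • n₃ = 0 →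
      α = 0 ∧ β = 0 ∧ γ = 0 ∧ δ = 0 := by
    intro α β γ δ e
    have h := hind (α - β * l₁ - γ * l₂ - δ * l₃) β γ δ (by
      simp only [hn₁, hn₂, hn₃, Algebra.smul_def, map_sub, map_mul] at e ⊢
      linear_combination e)
    obtain ⟨hα, hβ, hγ, hδ⟩ := h
    subst hβ hγ hδ
    exact ⟨by simpa using hα, rfl, rfl, rfl⟩
  have h13 : n₁ * n₃ = 0 := by
    obtain ⟨s, hs⟩ := h₁ n₃
    obtain ⟨t, ht⟩ := h₃ n₁
    have := hind' 0 s 0 (-t) (by rw [neg_smul, ← hs, ← ht]; simp [mul_comm])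
    rw [hs, this.2.1, zero_smul]
  have h23 : n₂ * n₃ = 0 := by
    obtain ⟨s, hs⟩ := h₂ n₃
    obtain ⟨t, ht⟩ := h₃ n₂
    have := hind' 0 0 s (-t) (by rw [neg_smul, ← hs, ← ht]; simp [mul_comm])
    rw [hs, this.2.2.1, zero_smul]
  have h12 : n₁ + n₂ ∉ span k {(1 : B)} := by
    intro h
    obtain ⟨t, ht⟩ := mem_span_singleton.mp h
    have := hind' (-t) 1 1 0 (by rw [neg_smul, ht]; simp)
    exact one_ne_zero this.2.1
  obtain ⟨l, hl⟩ := exists_forall_sub_mul_eq_smul h4 H h12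
  have hl0 : l = 0 := by
    obtain ⟨s, hs⟩ := hl n₃
    have := hind' (s * l) (-s) (-s) (-l) (by
      simp only [Algebra.smul_def, map_mul, map_neg] at hs ⊢
      linear_combination hs - h13 - h23)
    exact neg_eq_zero.mp this.2.2.2
  rw [hl0, map_zero, sub_zero] at hl
  -- The eigenvectors `n₁`, `n₂` and `n₁ + n₂` force the eigenvalues to agree.
  have hsame : ∀ d, ∃ s : k, n₁ * d = s • n₁ ∧ n₂ * d = s • n₂ := by
    intro d
    obtain ⟨s, hs⟩ := hl d
    obtain ⟨s₁, hs₁⟩ := h₁ d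
    obtain ⟨s₂, hs₂⟩ := h₂ d
    have := hind' 0 (s₁ - s) (s₂ - s) 0 (by
      simp only [Algebra.smul_def, map_sub, map_zero] at hs hs₁ hs₂ ⊢
      linear_combination hs - hs₁ - hs₂)
    refine ⟨s, ?_, ?_⟩
    · rw [hs₁, sub_eq_zero.mp this.2.1]
    · rw [hs₂, sub_eq_zero.mp this.2.2.1]
  obtain ⟨e, he⟩ := hprin n₁ n₂
  obtain ⟨x, y, hxy⟩ := Ideal.mem_span_pair.mp (he ▸ Ideal.mem_span_singleton_self e)
  obtain ⟨α, hα, -⟩ := hsame x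
  obtain ⟨β, -, hβ⟩ := hsame y
  have heq : e = α • n₁ + β • n₂ := by rw [← hxy, ← hα, ← hβ]; ring
  have hmul : ∀ n ∈ Ideal.span {n₁, n₂}, ∃ s : k, n = (s * α) • n₁ + (s * β) • n₂ := by
    intro n hn
    rw [he] at hn
    obtain ⟨u, rfl⟩ := Ideal.mem_span_singleton'.mp hn
    obtain ⟨s, hs₁, hs₂⟩ := hsame u
    refine ⟨s, ?_⟩
    simp only [heq, Algebra.smul_def, map_mul] at hs₁ hs₂ ⊢
    linear_combination algebraMap k B α * hs₁ + algebraMap k B β * hs₂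
  obtain ⟨s, hs⟩ := hmul n₁ (Ideal.subset_span (by simp))
  obtain ⟨t, ht⟩ := hmul n₂ (Ideal.subset_span (by simp))
  have e₁ := hind' 0 (s * α - 1) (s * β) 0 (by
    simp only [Algebra.smul_def, map_sub, map_mul, map_zero, map_one] at hs ⊢
    linear_combination -hs)
  have e₂ := hind' 0 (t * α) (t * β - 1) 0 (by
    simp only [Algebra.smul_def, map_sub, map_mul, map_zero, map_one] at ht ⊢
    linear_combination -ht)
  have hs0 : s ≠ 0 := by rintro rfl; simpa using e₁.2.1
  have hβ0 : β = 0 := (mul_eq_zero.mp e₁.2.2.1).resolve_left hs0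
  rw [hβ0] at e₂
  simpa using e₂.2.2.1

end

/-! ### The overring `R + mO` -/

/-- The ring `R + mO` between `R` and `O`: the elements of `O` whose residue class modulo `mO` comes
from `R`. -/
noncomputable def scalarOverring {R F : Type*} [CommRing R] [Field F] [Algebra R F]
    (O : Subalgebra R F) (m : Ideal R) : Subalgebra R F :=
  ((⊥ : Subalgebra R (O ⧸ m.map (algebraMap R O))).comap (Ideal.Quotient.mkₐ R _)).map O.val

section

variable {R F : Type*} [CommRing R] [Field F] [Algebra R F] {O : Subalgebra R F} {m : Ideal R}

theorem mem_scalarOverring {x : F} : x ∈ scalarOverring O m ↔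
    ∃ y : O, ∃ r : R, y - algebraMap R O r ∈ m.map (algebraMap R O) ∧ (y : F) = x := by
  constructor
  · rintro ⟨y, ⟨r, hr⟩, hyx⟩
    refine ⟨y, r, ?_, hyx⟩
    rw [← Ideal.Quotient.eq]
    exact hr.symm
  · rintro ⟨y, r, hr, hyx⟩
    refine ⟨y, ⟨r, ?_⟩, hyx⟩
    rw [← Ideal.Quotient.eq] at hr
    exact hr.symm

theorem scalarOverring_le : scalarOverring O m ≤ O := by
  intro x hx
  obtain ⟨y, -, -, rfl⟩ := mem_scalarOverring.mp hx
  exact y.2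

theorem coe_mem_scalarOverring {y : O} (hy : y ∈ m.map (algebraMap R O)) :
    (y : F) ∈ scalarOverring O m :=
  mem_scalarOverring.mpr ⟨y, 0, by simpa using hy, rfl⟩

theorem algebraMap_mul_mem_scalarOverring {z : R} (hz : z ∈ m) (a : O) :
    algebraMap R F z * a ∈ scalarOverring O m := by
  have := coe_mem_scalarOverring (Ideal.mul_mem_right a _ (Ideal.mem_map_of_mem (algebraMap R O) hz))
  exact this

/-- Linear independence of `1, a, b, a * b` over `R ⧸ m` in `O ⧸ mO`, expressed in `O`. -/
theorem mem_of_sum_mem_map [m.IsMaximal] {a b : O}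
    (ha : Ideal.Quotient.mk (m.map (algebraMap R O)) a ∉ span (R ⧸ m) {1})
    (hb : Ideal.Quotient.mk (m.map (algebraMap R O)) b ∉
      span (R ⧸ m) {1, Ideal.Quotient.mk (m.map (algebraMap R O)) a})
    (hab : Ideal.Quotient.mk (m.map (algebraMap R O)) a *
        Ideal.Quotient.mk (m.map (algebraMap R O)) b ∉
      span (R ⧸ m) {1, Ideal.Quotient.mk (m.map (algebraMap R O)) a,
        Ideal.Quotient.mk (m.map (algebraMap R O)) b}) {r s t u : R}
    (h : algebraMap R O r * a + algebraMap R O s * b + algebraMap R O t * (a * b) -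
      algebraMap R O u ∈ m.map (algebraMap R O)) : r ∈ m ∧ s ∈ m ∧ t ∈ m := by
  set mO := m.map (algebraMap R O)
  have key : ∀ t : R, t ∉ m → ∃ y, y * t - 1 ∈ m := fun t ht => by
    obtain ⟨y, i, hi, hyi⟩ := Ideal.IsMaximal.exists_inv ‹_› ht
    exact ⟨y, by rw [← hyi]; simpa using m.neg_mem hi⟩
  have hm : ∀ i ∈ m, Ideal.Quotient.mk mO (algebraMap R O i) = 0 := fun i hi =>
    Ideal.Quotient.eq_zero_iff_mem.mpr (Ideal.mem_map_of_mem _ hi)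
  have hs : ∀ (r : R) (x : O ⧸ mO), (Ideal.Quotient.mk m r) • x =
      Ideal.Quotient.mk mO (algebraMap R O r) * x := fun r x => by
    rw [Algebra.smul_def]; rfl
  have h0 : Ideal.Quotient.mk mO (algebraMap R O r) * Ideal.Quotient.mk mO a +
      Ideal.Quotient.mk mO (algebraMap R O s) * Ideal.Quotient.mk mO b +
      Ideal.Quotient.mk mO (algebraMap R O t) * (Ideal.Quotient.mk mO a * Ideal.Quotient.mk mO b) -
      Ideal.Quotient.mk mO (algebraMap R O u) = 0 := by
    have := Ideal.Quotient.eq_zero_iff_mem.mpr h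
    simpa only [map_add, map_sub, map_mul] using this
  have ht : t ∈ m := by
    by_contra hne
    obtain ⟨y, hy⟩ := key t hne
    have hy' := hm _ hy
    simp only [map_sub, map_mul, map_one] at hy'
    refine hab (mem_span_triple.mpr ⟨Ideal.Quotient.mk m (y * u), Ideal.Quotient.mk m (-y * r),
      Ideal.Quotient.mk m (-y * s), ?_⟩)
    simp only [hs]
    simp only [map_mul, map_neg]
    linear_combination Ideal.Quotient.mk mO a * Ideal.Quotient.mk mO b * hy' -
      Ideal.Quotient.mk mO (algebraMap R O y) * h0
  rw [hm t ht, zero_mul, add_zero] at h0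
  have hs' : s ∈ m := by
    by_contra hne
    obtain ⟨y, hy⟩ := key s hne
    have hy' := hm _ hy
    simp only [map_sub, map_mul, map_one] at hy'
    refine hb (mem_span_pair.mpr ⟨Ideal.Quotient.mk m (y * u), Ideal.Quotient.mk m (-y * r), ?_⟩)
    simp only [hs]
    simp only [map_mul, map_neg]
    linear_combination Ideal.Quotient.mk mO b * hy' -
      Ideal.Quotient.mk mO (algebraMap R O y) * h0
  rw [hm s hs', zero_mul, add_zero] at h0
  refine ⟨?_, hs', ht⟩
  by_contra hne
  obtain ⟨y, hy⟩ := key r hne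
  have hy' := hm _ hy
  simp only [map_sub, map_mul, map_one] at hy'
  refine ha (mem_span_singleton.mpr ⟨Ideal.Quotient.mk m (y * u), ?_⟩)
  simp only [hs]
  simp only [map_mul]
  linear_combination Ideal.Quotient.mk mO a * hy' - Ideal.Quotient.mk mO (algebraMap R O y) * h0

/-- For `z ∈ m` and `a ∈ O`, the index of `z R'` in the ideal `(z, z a)` of `R' = R + mO` is at most
the cardinality of `R ⧸ m`. -/
theorem relCard_span_pair_le [Finite (R ⧸ m)] {z za : scalarOverring O m} {a : O}
    (hza : (za : F) = z * a) :
    relCard (Ideal.span {z}) (Ideal.span {z, za}) ≤ Nat.card (R ⧸ m) := by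
  let R' := scalarOverring O m
  let j : R' →+* O := (Subalgebra.inclusion scalarOverring_le).toRingHom
  let m' : Ideal R' := (m.map (algebraMap R O)).comap j
  let φ : R →+* R' ⧸ m' := (Ideal.Quotient.mk m').comp (algebraMap R R')
  have hφ : ∀ r ∈ m, φ r = 0 := fun r hr => Ideal.Quotient.eq_zero_iff_mem.mpr
    (show j (algebraMap R R' r) ∈ m.map (algebraMap R O) from
      Ideal.mem_map_of_mem (algebraMap R O) hr)
  have hsurj : Function.Surjective (Ideal.Quotient.lift m φ hφ) := by
    intro y
    obtain ⟨y, rfl⟩ := Ideal.Quotient.mk_surjective y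
    obtain ⟨x, r, hxr, hx⟩ := mem_scalarOverring.mp y.2
    refine ⟨Ideal.Quotient.mk m r, ?_⟩
    rw [Ideal.Quotient.lift_mk]
    symm
    refine (Ideal.Quotient.eq).mpr ?_
    change j (y - algebraMap R R' r) ∈ m.map (algebraMap R O)
    rw [map_sub, show j y = x from Subtype.ext hx.symm]
    exact hxr
  have : Finite (R' ⧸ m') := Finite.of_surjective _ hsurj
  have h1 : relCard m' ⊤ ≤ Nat.card (R ⧸ m) := by
    rw [relCard_top, cardQuot_apply]
    exact Nat.card_le_card_of_surjective _ hsurj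
  refine le_trans (relCard_le_relCard_of_cyclic (N' := m') (P' := ⊤) (p := za) (q := (1 : R'))
    ?_ mem_top ?_) h1
  · rw [Ideal.span_insert]
  · intro r hr
    have hr' : j r ∈ m.map (algebraMap R O) := by
      rw [smul_eq_mul, mul_one] at hr
      exact hr
    have hra := coe_mem_scalarOverring (Ideal.mul_mem_right a _ hr')
    refine Ideal.mem_span_singleton'.mpr ⟨⟨_, hra⟩, ?_⟩
    apply Subtype.ext
    change (r : F) * a * z = r * za
    rw [hza]
    ring

/-- Under linear independence of `1, a, b, a * b` modulo `mO`, the combinations of `z² a`, `z² b` and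
`z² a b` with coefficients in `R ⧸ m` are distinct modulo `z² R'`. -/
theorem pow_three_le_relCard [m.IsMaximal] {z za zb : scalarOverring O m} {a b : O}
    (hz : z ≠ 0) (hza : (za : F) = z * a) (hzb : (zb : F) = z * b)
    [Finite (scalarOverring O m ⧸ Ideal.span {z * z})]
    (hind : ∀ r s t u : R, algebraMap R O r * a + algebraMap R O s * b +
      algebraMap R O t * (a * b) - algebraMap R O u ∈ m.map (algebraMap R O) →
        r ∈ m ∧ s ∈ m ∧ t ∈ m) :
    Nat.card (R ⧸ m) ^ 3 ≤
      relCard (Ideal.span {z * z}) (Ideal.span {z, za} * Ideal.span {z, zb}) := by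
  let R' := scalarOverring O m
  rw [relCard_eq_card_map]
  let w : (R ⧸ m) × (R ⧸ m) × (R ⧸ m) → R' := fun p =>
    algebraMap R R' p.1.out * (za * z) + algebraMap R R' p.2.1.out * (z * zb) +
      algebraMap R R' p.2.2.out * (za * zb)
  have hw : ∀ p, w p ∈ Ideal.span {z, za} * Ideal.span {z, zb} := by
    intro p
    have h1 : z ∈ Ideal.span {z, za} := Ideal.subset_span (by simp)
    have h2 : za ∈ Ideal.span {z, za} := Ideal.subset_span (by simp)
    have h3 : z ∈ Ideal.span {z, zb} := Ideal.subset_span (by simp)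
    have h4 : zb ∈ Ideal.span {z, zb} := Ideal.subset_span (by simp)
    exact add_mem (add_mem (Ideal.mul_mem_left _ _ (Ideal.mul_mem_mul h2 h3))
      (Ideal.mul_mem_left _ _ (Ideal.mul_mem_mul h1 h4)))
      (Ideal.mul_mem_left _ _ (Ideal.mul_mem_mul h2 h4))
  have hcard : Nat.card (R ⧸ m) ^ 3 = Nat.card ((R ⧸ m) × (R ⧸ m) × (R ⧸ m)) := by
    rw [Nat.card_prod, Nat.card_prod]
    ring
  rw [hcard]
  refine Nat.card_le_card_of_injective
    (fun p => (⟨(Ideal.span {z * z}).mkQ (w p), mem_map_of_mem (hw p)⟩ :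
      map (Ideal.span {z * z}).mkQ (Ideal.span {z, za} * Ideal.span {z, zb}))) ?_
  intro p p' hpp'
  have h1 : (Ideal.span {z * z}).mkQ (w p) = (Ideal.span {z * z}).mkQ (w p') :=
    congrArg Subtype.val hpp'
  have h2 : w p - w p' ∈ Ideal.span {z * z} := (Submodule.Quotient.eq _).mp h1
  obtain ⟨v, hv⟩ := Ideal.mem_span_singleton'.mp h2
  have hz0 : (z : F) ≠ 0 := fun h => hz (Subtype.ext h)
  have hvF : (v : F) = algebraMap R F (p.1.out - p'.1.out) * a +
      algebraMap R F (p.2.1.out - p'.2.1.out) * b +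
      algebraMap R F (p.2.2.out - p'.2.2.out) * (a * b) := by
    have h3 : (v : F) * (z * z) = (algebraMap R F p.1.out * (za * z) +
        algebraMap R F p.2.1.out * (z * zb) + algebraMap R F p.2.2.out * (za * zb)) -
        (algebraMap R F p'.1.out * (za * z) +
        algebraMap R F p'.2.1.out * (z * zb) + algebraMap R F p'.2.2.out * (za * zb)) :=
      congrArg Subtype.val hv
    rw [hza, hzb] at h3
    apply mul_right_cancel₀ (mul_ne_zero hz0 hz0)
    rw [h3]
    simp only [map_sub]
    ring
  obtain ⟨y, u, hyu, hy⟩ := mem_scalarOverring.mp v.2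
  have h4 := hind (p.1.out - p'.1.out) (p.2.1.out - p'.2.1.out) (p.2.2.out - p'.2.2.out) u (by
    convert! hyu using 2
    apply Subtype.ext
    rw [hy, hvF]
    rfl)
  have hout : ∀ x x' : R ⧸ m, x.out - x'.out ∈ m → x = x' := fun x x' h => by
    have := (Ideal.Quotient.eq (I := m)).mpr h
    simpa using this
  exact Prod.ext (hout _ _ h4.1) (Prod.ext (hout _ _ h4.2.1) (hout _ _ h4.2.2))

/-- If `1, a, b, a * b` are linearly independent in `O ⧸ mO`, then the ideals `(z, z a)` and `(z, z b)`
of `R + mO`, where `0 ≠ z ∈ m`, violate super-multiplicativity. -/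
theorem not_isSuperMultiplicative_scalarOverring [FaithfulSMul R F] [m.IsMaximal] [Finite (R ⧸ m)]
    [Ring.HasFiniteQuotients (scalarOverring O m)] (hm : m ≠ ⊥) {a b : O}
    (ha : Ideal.Quotient.mk (m.map (algebraMap R O)) a ∉ span (R ⧸ m) {1})
    (hb : Ideal.Quotient.mk (m.map (algebraMap R O)) b ∉
      span (R ⧸ m) {1, Ideal.Quotient.mk (m.map (algebraMap R O)) a})
    (hab : Ideal.Quotient.mk (m.map (algebraMap R O)) a *
        Ideal.Quotient.mk (m.map (algebraMap R O)) b ∉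
      span (R ⧸ m) {1, Ideal.Quotient.mk (m.map (algebraMap R O)) a,
        Ideal.Quotient.mk (m.map (algebraMap R O)) b}) :
    ¬ IsSuperMultiplicative (scalarOverring O m) := by
  intro hsuper
  obtain ⟨z₀, hz₀, hz₀0⟩ := exists_mem_ne_zero_of_ne_bot hm
  let R' := scalarOverring O m
  let z : R' := algebraMap R R' z₀
  let za : R' := ⟨_, algebraMap_mul_mem_scalarOverring hz₀ a⟩
  let zb : R' := ⟨_, algebraMap_mul_mem_scalarOverring hz₀ b⟩
  have hz : z ≠ 0 := fun h => hz₀0 (FaithfulSMul.algebraMap_injective R F (by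
    rw [map_zero]; exact congrArg Subtype.val h))
  let I : Ideal R' := Ideal.span {z, za}
  let J : Ideal R' := Ideal.span {z, zb}
  have hzz : Ideal.span {z * z} ≠ ⊥ := by simpa using hz
  have hle : Ideal.span {z * z} ≤ I * J := (Ideal.span_singleton_le_iff_mem _).mpr
    (Ideal.mul_mem_mul (Ideal.subset_span (by simp)) (Ideal.subset_span (by simp)))
  have hIJ : I * J ≠ ⊥ := fun h => hzz (le_bot_iff.mp (h ▸ hle))
  have := Ring.HasFiniteQuotients.finiteQuotient hzz
  have := Ring.HasFiniteQuotients.finiteQuotient hIJ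
  have hpos := Ring.HasFiniteQuotients.cardQuot_pos _ hIJ
  have h : cardQuot I * cardQuot J ≤ cardQuot (I * J) := hsuper I J ⟨hpos.ne'⟩
  set q := Nat.card (R ⧸ m) with hq
  have hq1 : 1 < q := by
    have : Nontrivial (R ⧸ m) := Ideal.Quotient.nontrivial_iff.mpr (Ideal.IsMaximal.ne_top ‹_›)
    exact Finite.one_lt_card
  have hI := relCard_mul_cardQuot (show Ideal.span {z} ≤ I from span_mono (by simp))
  have hJ := relCard_mul_cardQuot (show Ideal.span {z} ≤ J from span_mono (by simp))
  have hIJ' := relCard_mul_cardQuot hle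
  have hD := cardQuot_span_singleton_mul hz (Ideal.span {z})
  rw [Ideal.span_singleton_mul_span_singleton] at hD
  have hI' : relCard (Ideal.span {z}) I ≤ q := relCard_span_pair_le rfl
  have hJ' : relCard (Ideal.span {z}) J ≤ q := relCard_span_pair_le rfl
  have hL : q ^ 3 ≤ relCard (Ideal.span {z * z}) (I * J) :=
    pow_three_le_relCard hz rfl rfl fun r s t u => mem_of_sum_mem_map ha hb hab
  have h1 : q ^ 3 * cardQuot (I * J) ≤ q ^ 2 * cardQuot (I * J) := by
    calc q ^ 3 * cardQuot (I * J) ≤ cardQuot (Ideal.span {z * z}) := by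
          rw [← hIJ']; exact Nat.mul_le_mul_right _ hL
      _ = (relCard (Ideal.span {z}) I * cardQuot I) * (relCard (Ideal.span {z}) J * cardQuot J) := by
          rw [hD, hI, hJ]
      _ ≤ (q * cardQuot I) * (q * cardQuot J) :=
          Nat.mul_le_mul (Nat.mul_le_mul_right _ hI') (Nat.mul_le_mul_right _ hJ')
      _ = q ^ 2 * (cardQuot I * cardQuot J) := by ring
      _ ≤ _ := Nat.mul_le_mul_left _ h
  have h2 := Nat.le_of_mul_le_mul_right h1 hpos
  exact absurd h2 (not_le.mpr (Nat.pow_lt_pow_right hq1 (by norm_num)))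

end

/-! ### The conductor -/

/-- Invertibility of the fractional ideal generated by `1` and `x`. -/
theorem IsDedekindDomain.exists_add_mul_eq_one {D F : Type*} [CommRing D] [IsDedekindDomain D]
    [Field F] [Algebra D F] [IsFractionRing D F] (x : F) :
    ∃ u v : D, algebraMap D F u + algebraMap D F v * x = 1 ∧
      (∃ w, algebraMap D F w = algebraMap D F u * x) ∧
      ∃ w, algebraMap D F w = algebraMap D F v * x := by
  let X : FractionalIdeal D⁰ F :=
    FractionalIdeal.spanSingleton D⁰ 1 + FractionalIdeal.spanSingleton D⁰ x
  have h1X : (1 : F) ∈ X := by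
    rw [FractionalIdeal.mem_add]
    exact ⟨1, FractionalIdeal.mem_spanSingleton_self _ _, 0, FractionalIdeal.zero_mem _, add_zero _⟩
  have hxX : x ∈ X := by
    rw [FractionalIdeal.mem_add]
    exact ⟨0, FractionalIdeal.zero_mem _, x, FractionalIdeal.mem_spanSingleton_self _ _, zero_add _⟩
  have hX : X ≠ 0 := fun h => one_ne_zero ((FractionalIdeal.mem_zero_iff D⁰).mp (h ▸ h1X))
  have hmul : X * X⁻¹ = 1 := mul_inv_cancel₀ hX
  have h1 : (1 : F) ∈ X * X⁻¹ := by rw [hmul]; exact FractionalIdeal.one_mem_one _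
  rw [add_mul, FractionalIdeal.mem_add] at h1
  obtain ⟨u, hu, w, hw, huw⟩ := h1
  rw [FractionalIdeal.mem_singleton_mul] at hu hw
  obtain ⟨u', hu', rfl⟩ := hu
  obtain ⟨v, hv, rfl⟩ := hw
  rw [FractionalIdeal.mem_inv_iff hX] at hu' hv
  have hmem : ∀ y : F, y ∈ (1 : FractionalIdeal D⁰ F) → ∃ d, algebraMap D F d = y := fun y hy =>
    (FractionalIdeal.mem_one_iff D⁰).mp hy
  obtain ⟨a, ha⟩ := hmem _ (hu' 1 h1X)
  obtain ⟨b, hb⟩ := hmem _ (hv 1 h1X)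
  obtain ⟨c, hc⟩ := hmem _ (hu' x hxX)
  obtain ⟨d, hd⟩ := hmem _ (hv x hxX)
  rw [mul_one] at ha hb
  refine ⟨a, b, ?_, ⟨c, ?_⟩, ⟨d, ?_⟩⟩
  · rw [ha, hb, ← huw]; ring
  · rw [hc, ha]
  · rw [hd, hb]

/-- An overring `E` of a Dedekind domain `D` contains every element integral over a subring `R` of
`E`: if `u + v x = 1` with `u, v, u x, v x ∈ D`, an integral equation of degree `n` for `x`,
multiplied by `v ^ (n - 1)`, shows that `(1 - u) ^ (n - 1) x ∈ E`, and `u x ∈ E`. -/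
theorem IsIntegral.mem_of_isDedekindDomain_le {R D F : Type*} [CommRing R] [CommRing D]
    [IsDedekindDomain D] [Field F] [Algebra D F] [IsFractionRing D F] [Algebra R F]
    (E : Subalgebra R F) (hE : ∀ d : D, algebraMap D F d ∈ E) {x : F} (hx : IsIntegral R x) :
    x ∈ E := by
  obtain ⟨u, v, huv, ⟨w, hw⟩, ⟨w', hw'⟩⟩ := IsDedekindDomain.exists_add_mul_eq_one (D := D) x
  have hu := hE u
  have hv := hE v
  have hux := hw ▸ hE w
  have hvx := hw' ▸ hE w'
  set u' := algebraMap D F u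
  set v' := algebraMap D F v
  have hstep : ∀ n : ℕ, (1 - u') ^ n * x ∈ E → x ∈ E := by
    intro n
    induction n with
    | zero => intro h; simpa using h
    | succ n ih =>
      intro h
      apply ih
      have e : (1 - u') ^ n * x = (1 - u') ^ (n + 1) * x + (1 - u') ^ n * (u' * x) := by ring
      rw [e]
      exact E.add_mem h (E.mul_mem (E.pow_mem (E.sub_mem E.one_mem hu) n) hux)
  obtain ⟨p, hp, hpx⟩ := hx
  rcases Nat.eq_zero_or_pos p.natDegree with h0 | hpos
  · rw [Polynomial.eq_one_of_monic_natDegree_zero hp h0, Polynomial.eval₂_one] at hpx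
    exact absurd hpx one_ne_zero
  · apply hstep (p.natDegree - 1)
    have e : (1 - u') ^ (p.natDegree - 1) * x = v' ^ (p.natDegree - 1) * x ^ p.natDegree := by
      rw [show 1 - u' = v' * x by rw [← huv]; ring, mul_pow, mul_assoc, ← pow_succ]
      congr 2
      omega
    rw [Polynomial.eval₂_eq_sum_range, Finset.sum_range_succ, hp.coeff_natDegree, map_one,
      one_mul] at hpx
    rw [e, eq_neg_of_add_eq_zero_right hpx, mul_neg, Finset.mul_sum]
    refine E.neg_mem (E.sum_mem fun i hi => ?_)
    have hi' : i ≤ p.natDegree - 1 := by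
      have := Finset.mem_range.mp hi
      omega
    have e2 : v' ^ (p.natDegree - 1) * (algebraMap R F (p.coeff i) * x ^ i) =
        algebraMap R F (p.coeff i) * (v' ^ (p.natDegree - 1 - i) * (v' * x) ^ i) := by
      rw [← Nat.sub_add_cancel hi', pow_add, Nat.add_sub_cancel]
      ring
    rw [e2]
    exact E.mul_mem (E.algebraMap_mem _) (E.mul_mem (E.pow_mem hv _) (E.pow_mem hvx _))

/-- The conductor of a number ring in its normalization is nonzero. A common denominator `c` of
generators of the ring of integers `D` of `F` satisfies `c D ⊆ R`, hence `c RD ⊆ R`, and the overring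
`RD` of `D` contains the normalization of `R`. -/
theorem exists_mul_mem_range_of_isIntegral (R F : Type*) [CommRing R] [Field F] [NumberField F]
    [Algebra R F] [IsFractionRing R F] :
    ∃ c : R, c ≠ 0 ∧ ∀ x : F, IsIntegral R x → ∃ r : R, algebraMap R F r = algebraMap R F c * x := by
  classical
  have : IsDomain R := (IsFractionRing.injective R F).isDomain (algebraMap R F)
  let D := NumberField.RingOfIntegers F
  obtain ⟨s, hs⟩ := (Module.Finite.fg_top : (⊤ : Submodule ℤ D).FG)
  obtain ⟨c, hc⟩ := IsLocalization.exist_integer_multiples_of_finset R⁰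
    (s.image (algebraMap D F))
  refine ⟨c, nonZeroDivisors.ne_zero c.2, fun x hx => ?_⟩
  have hcD : ∀ d : D, ∃ r : R, algebraMap R F r = algebraMap R F c * algebraMap D F d := by
    intro d
    have hd : d ∈ span ℤ (s : Set D) := hs ▸ mem_top
    induction hd using span_induction with
    | mem d hd =>
      obtain ⟨r, hr⟩ := hc _ (Finset.mem_image_of_mem _ hd)
      exact ⟨r, hr.trans (Algebra.smul_def _ _)⟩
    | zero => exact ⟨0, by simp⟩
    | add d d' _ _ h h' =>
      obtain ⟨r, hr⟩ := h
      obtain ⟨r', hr'⟩ := h'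
      exact ⟨r + r', by rw [map_add, map_add, mul_add, hr, hr']⟩
    | smul n d _ h =>
      obtain ⟨r, hr⟩ := h
      exact ⟨n • r, by rw [map_zsmul, map_zsmul, hr, mul_smul_comm]⟩
  let E : Subalgebra R F := Algebra.adjoin R (Set.range (algebraMap D F))
  have hxE : x ∈ E := IsIntegral.mem_of_isDedekindDomain_le (D := D) E
    (fun d => Algebra.subset_adjoin ⟨d, rfl⟩) hx
  have hE : Subalgebra.toSubmodule E = span R (Set.range (algebraMap D F)) := by
    rw [Algebra.adjoin_eq_span]
    congr 1
    exact congrArg SetLike.coe (Submonoid.closure_eq (MonoidHom.mrange (algebraMap D F).toMonoidHom))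
  have hxE' : x ∈ span R (Set.range (algebraMap D F)) := hE ▸ hxE
  clear hx hxE
  induction hxE' using span_induction with
  | mem x hx =>
    obtain ⟨d, rfl⟩ := hx
    exact hcD d
  | zero => exact ⟨0, by simp⟩
  | add x y _ _ h h' =>
    obtain ⟨r, hr⟩ := h
    obtain ⟨r', hr'⟩ := h'
    exact ⟨r + r', by rw [map_add, mul_add, hr, hr']⟩
  | smul a x _ h =>
    obtain ⟨r, hr⟩ := h
    exact ⟨a * r, by rw [map_mul, hr, Algebra.smul_def]; ring⟩

/-! ### Residue fields and indices -/

section ResidueField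

variable {R M : Type*} [CommRing R] [AddCommGroup M] [Module R M] {m : Ideal R}

/-- If `m P ≤ N`, the index of `N` in `P` is a power of the cardinality of the residue field. -/
theorem exists_relCard_eq_pow [m.IsMaximal] [Finite (R ⧸ m)] {N P : Submodule R M} [Finite (M ⧸ N)]
    (h : m • P ≤ N) : ∃ n, relCard N P = Nat.card (R ⧸ m) ^ n := by
  let : Field (R ⧸ m) := Ideal.Quotient.field m
  have htors : Module.IsTorsionBySet R (P.map N.mkQ) (m : Set R) := by
    rintro ⟨_, x, hx, rfl⟩ ⟨a, ha⟩
    apply Subtype.ext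
    change a • N.mkQ x = 0
    rw [← map_smul, mkQ_apply, Quotient.mk_eq_zero]
    exact h (smul_mem_smul ha hx)
  let : Module (R ⧸ m) (P.map N.mkQ) := htors.module
  exact ⟨_, (relCard_eq_card_map N P).trans Module.natCard_eq_pow_finrank⟩

theorem one_lt_card_quotient (m : Ideal R) [m.IsMaximal] [Finite (R ⧸ m)] :
    1 < Nat.card (R ⧸ m) := by
  have : Nontrivial (R ⧸ m) := Ideal.Quotient.nontrivial_iff.mpr (Ideal.IsMaximal.ne_top ‹_›)
  exact Finite.one_lt_card

theorem card_le_relCard_of_not_le [m.IsMaximal] [Finite (R ⧸ m)] {N P : Submodule R M}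
    [Finite (M ⧸ N)] (h : m • P ≤ N) (hPN : ¬ P ≤ N) : Nat.card (R ⧸ m) ≤ relCard N P := by
  obtain ⟨n, hn⟩ := exists_relCard_eq_pow h
  rcases Nat.eq_zero_or_pos n with rfl | hpos
  · rw [pow_zero] at hn
    exact absurd (relCard_eq_one_iff.mp hn) hPN
  · rw [hn]
    exact Nat.le_self_pow hpos.ne' _

theorem relCard_sup_span_singleton_le [Finite (R ⧸ m)] {N P : Submodule R M}
    (h : m • P ≤ N) {u : M} (hu : u ∈ P) : relCard N (N ⊔ span R {u}) ≤ Nat.card (R ⧸ m) := by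
  rw [← cardQuot_apply, ← relCard_top]
  refine relCard_le_relCard_of_cyclic (q := (1 : R)) le_rfl mem_top fun r hr => ?_
  rw [smul_eq_mul, mul_one] at hr
  exact h (smul_mem_smul hr hu)

/-- A step `N < N + R u ≤ P` decreases the index by a factor of at least the cardinality of the
residue field. -/
theorem card_mul_relCard_le [m.IsMaximal] [Finite (R ⧸ m)] {N P : Submodule R M}
    [Finite (M ⧸ N)] (h : m • P ≤ N) (hNP : N ≤ P) {u : M} (hu : u ∈ P) (huN : u ∉ N) :
    Nat.card (R ⧸ m) * relCard (N ⊔ span R {u}) P ≤ relCard N P := by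
  have hle : N ⊔ span R {u} ≤ P := sup_le hNP ((span_singleton_le_iff_mem _ _).mpr hu)
  rw [← relCard_mul_relCard le_sup_left hle]
  refine Nat.mul_le_mul_right _ (card_le_relCard_of_not_le ((smul_mono_right _ hle).trans h) ?_)
  intro h'
  exact huN (h' (mem_sup_right (mem_span_singleton_self u)))

theorem le_sup_span_singleton_of_relCard_le [m.IsMaximal] [Finite (R ⧸ m)] {N P : Submodule R M}
    [Finite (M ⧸ N)] (h : m • P ≤ N) (hNP : N ≤ P) (hcard : relCard N P ≤ Nat.card (R ⧸ m))
    {u : M} (hu : u ∈ P) (huN : u ∉ N) : P ≤ N ⊔ span R {u} := by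
  have h1 := (card_mul_relCard_le h hNP hu huN).trans hcard
  have hq := one_lt_card_quotient m
  have : Finite (M ⧸ (N ⊔ span R {u})) :=
    Finite.of_surjective _ (factor_surjective (le_sup_left : N ≤ N ⊔ span R {u}))
  have hpos : 0 < relCard (N ⊔ span R {u}) P := relCard_pos
  have h2 : relCard (N ⊔ span R {u}) P ≤ 1 :=
    Nat.le_of_mul_le_mul_left (by simpa using h1) (by omega : 0 < Nat.card (R ⧸ m))
  exact relCard_eq_one_iff.mp (by omega)

end ResidueField

section Dedekind

variable {O : Type*} [CommRing O] [IsDedekindDomain O]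

theorem Ideal.le_of_mul_le_mul_left_of_ne_bot {I J K : Ideal O} (hI : I ≠ ⊥)
    (h : I * J ≤ I * K) : J ≤ K := by
  rw [← Ideal.dvd_iff_le] at h ⊢
  exact (mul_dvd_mul_iff_left hI).mp h

/-- In a Dedekind domain `L / IL` is cyclic with annihilator `I`. -/
theorem relCard_mul_self [Ring.HasFiniteQuotients O] {I L : Ideal O} (hI : I ≠ ⊥) (hL : L ≠ ⊥) :
    relCard (I * L) L = cardQuot I := by
  have hIL : I * L ≠ ⊥ := mul_ne_zero hI hL
  have := Ring.HasFiniteQuotients.finiteQuotient hI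
  have := Ring.HasFiniteQuotients.finiteQuotient hIL
  obtain ⟨a, ha⟩ := IsDedekindDomain.exists_sup_span_eq (Ideal.mul_le_right : I * L ≤ L) hIL
  have haL : a ∈ L := ha ▸ mem_sup_right (Ideal.mem_span_singleton_self a)
  rw [← relCard_top]
  apply le_antisymm
  · refine relCard_le_relCard_of_cyclic (p := a) (q := (1 : O)) ha.ge mem_top fun r hr => ?_
    rw [smul_eq_mul, mul_one] at hr
    exact Ideal.mul_mem_mul hr haL
  · refine relCard_le_relCard_of_cyclic (p := (1 : O)) (q := a) ?_ haL fun r hr => ?_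
    · rw [show span O {(1 : O)} = ⊤ from Ideal.span_singleton_one]
      exact le_sup_right
    · rw [smul_eq_mul, mul_one, ← Ideal.span_singleton_le_iff_mem]
      refine Ideal.le_of_mul_le_mul_left_of_ne_bot hL ?_
      rw [mul_comm L I, mul_comm]
      nth_rewrite 1 [← ha]
      rw [Ideal.mul_sup, Ideal.span_singleton_mul_span_singleton]
      exact sup_le Ideal.mul_le_right ((Ideal.span_singleton_le_iff_mem _).mpr hr)

end Dedekind

/-! ### Multiplication by a maximal ideal in a Dedekind extension -/

section

variable {R O : Type*} [CommRing R] [CommRing O] [IsDedekindDomain O] [Algebra R O]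
  [Ring.HasFiniteQuotients O] {m : Ideal R}

theorem finite_quotient_of_restrictScalars_le {R O : Type*} [CommRing R] [CommRing O] [Algebra R O]
    [Ring.HasFiniteQuotients O] {L : Ideal O} (hL : L ≠ ⊥) {N : Submodule R O}
    (h : L.restrictScalars R ≤ N) : Finite (O ⧸ N) := by
  have h1 := Ring.HasFiniteQuotients.finiteQuotient hL
  have : Finite (O ⧸ L.restrictScalars R) := h1
  exact Finite.of_surjective _ (factor_surjective h)

theorem smul_restrictScalars_eq {R O : Type*} [CommRing R] [CommRing O] [Algebra R O] (m : Ideal R)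
    (L : Ideal O) :
    m • L.restrictScalars R = (m.map (algebraMap R O) * L).restrictScalars R :=
  (Ideal.smul_restrictScalars m L).symm

theorem map_mul_span_singleton_le {R O : Type*} [CommRing R] [CommRing O] [Algebra R O]
    {m : Ideal R} {v : O} {K : Ideal O} (h : ∀ x ∈ m, x • v ∈ K) :
    m.map (algebraMap R O) * Ideal.span {v} ≤ K := by
  rw [Ideal.map, Ideal.span_mul_span', Ideal.span_le]
  rintro _ ⟨_, ⟨x, hx, rfl⟩, _, rfl, rfl⟩
  have := h x hx
  rwa [Algebra.smul_def] at this

theorem relCard_smul_restrictScalars (hm : m.map (algebraMap R O) ≠ ⊥) {L : Ideal O} (hL : L ≠ ⊥) :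
    relCard (m • L.restrictScalars R) (L.restrictScalars R) =
      cardQuot (m.map (algebraMap R O)) := by
  rw [smul_restrictScalars_eq]
  exact relCard_mul_self hm hL

/-- The case of `relCard_smul_le_of_pow_smul_le` in which `V` contains `mL`. If it failed, then
`mV / m²L` would be a line spanned by some `u` and `V / mL` would be a plane. By cancellation of
`mO`, all elements of `V` outside `mL` generate the same `O`-submodule modulo `mL`, whereas some
element of `m` kills one of them and not another one modulo `m²L`. -/
theorem relCard_smul_le_of_smul_le [m.IsMaximal] [Finite (R ⧸ m)]
    (hm : m.map (algebraMap R O) ≠ ⊥)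
    (hcard : cardQuot (m.map (algebraMap R O)) ≤ Nat.card (R ⧸ m) ^ 3) {L : Ideal O} (hL : L ≠ ⊥)
    {V : Submodule R O} (hVL : V ≤ L.restrictScalars R) (hmV : m • L.restrictScalars R ≤ V) :
    relCard (m • V) (m • L.restrictScalars R) ≤ relCard V (L.restrictScalars R) := by
  set mO := m.map (algebraMap R O) with hmO
  set q := Nat.card (R ⧸ m)
  have hq : 1 < q := one_lt_card_quotient m
  set L₀ := L.restrictScalars R with hL₀
  have e₁ : m • L₀ = (mO * L).restrictScalars R := smul_restrictScalars_eq m L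
  have e₂ : m • m • L₀ = (mO * (mO * L)).restrictScalars R := by
    rw [e₁]; exact smul_restrictScalars_eq m (mO * L)
  have hL1 : mO * L ≠ ⊥ := mul_ne_zero hm hL
  have hL2 : mO * (mO * L) ≠ ⊥ := mul_ne_zero hm hL1
  have hQ1 : relCard (m • L₀) L₀ = cardQuot mO := relCard_smul_restrictScalars hm hL
  have hQ2 : relCard (m • m • L₀) (m • L₀) = cardQuot mO := by
    have := relCard_smul_restrictScalars hm hL1
    rwa [← hmO, ← e₁] at this
  have hN2 : m • m • L₀ ≤ m • V := smul_mono_right _ hmV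
  have hWN : m • V ≤ m • L₀ := smul_mono_right _ hVL
  have hf2 : Finite (O ⧸ m • m • L₀) := finite_quotient_of_restrictScalars_le hL2 e₂.ge
  have hf1 : Finite (O ⧸ m • L₀) := finite_quotient_of_restrictScalars_le hL1 e₁.ge
  have hfV : Finite (O ⧸ V) := finite_quotient_of_restrictScalars_le hL1 (e₁.ge.trans hmV)
  have hfW : Finite (O ⧸ m • V) := finite_quotient_of_restrictScalars_le hL2 (e₂.ge.trans hN2)
  have hV := relCard_mul_relCard hmV hVL
  have hW := relCard_mul_relCard hN2 hWN
  -- As `L / mL` and `mL / m²L` have the same cardinality, the claim is `|V / mL| ≤ |mV / m²L|`.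
  suffices h : relCard (m • L₀) V ≤ relCard (m • m • L₀) (m • V) by
    have hpos : 0 < relCard (m • L₀) V := relCard_pos
    refine Nat.le_of_mul_le_mul_left ?_ hpos
    calc _ ≤ relCard (m • m • L₀) (m • V) * relCard (m • V) (m • L₀) := Nat.mul_le_mul_right _ h
      _ = _ := by rw [hW, hQ2, hV, hQ1]
  by_contra! hlt
  have hnot : ∀ v, v ∉ m • L₀ → ∃ x ∈ m, x • v ∉ m • m • L₀ := by
    intro v hv
    by_contra! hx
    apply hv
    rw [e₁]
    have h1 : mO * Ideal.span {v} ≤ mO * (mO * L) := map_mul_span_singleton_le fun x hxm => by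
      have := hx x hxm
      rwa [e₂] at this
    exact (Ideal.span_singleton_le_iff_mem _).mp (Ideal.le_of_mul_le_mul_left_of_ne_bot hm h1)
  have hdpos : 0 < relCard (m • m • L₀) (m • V) := relCard_pos
  have hVN : ¬ V ≤ m • L₀ := fun h => by
    rw [relCard_eq_one_iff.mpr h] at hlt
    omega
  obtain ⟨v₁, hv₁, hv₁N⟩ := SetLike.not_le_iff_exists.mp hVN
  obtain ⟨x, hx, hxv⟩ := hnot v₁ hv₁N
  have hdq : q ≤ relCard (m • m • L₀) (m • V) :=
    card_le_relCard_of_not_le (smul_mono_right _ hWN) fun h => hxv (h (smul_mem_smul hx hv₁))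
  have hLV : ¬ L₀ ≤ V := fun h => by
    rw [le_antisymm hVL h, hQ1, hQ2] at hlt
    omega
  have hqV : q ≤ relCard V L₀ := card_le_relCard_of_not_le hmV hLV
  have hc : relCard (m • L₀) V ≤ q ^ 2 := by
    have h1 : relCard (m • L₀) V * q ≤ q ^ 2 * q :=
      calc _ ≤ relCard (m • L₀) V * relCard V L₀ := Nat.mul_le_mul_left _ hqV
        _ = cardQuot mO := hV.trans hQ1
        _ ≤ q ^ 3 := hcard
        _ = q ^ 2 * q := by ring
    exact Nat.le_of_mul_le_mul_right h1 (by omega)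
  have hd : relCard (m • m • L₀) (m • V) ≤ q := by
    obtain ⟨j, hj⟩ := exists_relCard_eq_pow (N := m • m • L₀) (P := m • V) (smul_mono_right _ hWN)
    rw [hj] at hlt ⊢
    have : j < 2 := (Nat.pow_lt_pow_iff_right hq).mp (hlt.trans_le hc)
    calc q ^ j ≤ q ^ 1 := Nat.pow_le_pow_right (by omega) (by omega)
      _ = q := pow_one q
  have hgen : ∀ u ∈ m • V, u ∉ m • m • L₀ → m • V ≤ m • m • L₀ ⊔ span R {u} := fun u hu huN =>
    le_sup_span_singleton_of_relCard_le (smul_mono_right _ hWN) hN2 hd hu huN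
  have hv₂ : ∃ v₂ ∈ V, v₂ ∉ m • L₀ ⊔ span R {v₁} := by
    by_contra! h
    have h1 : V = m • L₀ ⊔ span R {v₁} :=
      le_antisymm h (sup_le hmV ((span_singleton_le_iff_mem _ _).mpr hv₁))
    have h2 := relCard_sup_span_singleton_le (N := m • L₀) (P := L₀) le_rfl (hVL hv₁)
    rw [← h1] at h2
    exact absurd (hdq.trans_lt hlt) (not_lt.mpr h2)
  obtain ⟨v₂, hv₂, hv₂N⟩ := hv₂
  -- `x` is injective on the line of `v₁`, so a combination `w` of `v₁` and `v₂` is killed by `x`.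
  have hmem : ∀ y ∈ m, ∀ v ∈ V, ∀ u ∈ m • V, u ∉ m • m • L₀ → ∃ s : R, y • v - s • u ∈ m • m • L₀ := by
    intro y hy v hv u hu huN
    obtain ⟨n, hn, z, hz, hnz⟩ := mem_sup.mp (hgen u hu huN (smul_mem_smul hy hv))
    obtain ⟨s, rfl⟩ := mem_span_singleton.mp hz
    exact ⟨s, by rw [← hnz, add_sub_cancel_right]; exact hn⟩
  have hu : x • v₁ ∈ m • V := smul_mem_smul hx hv₁
  obtain ⟨s, hs⟩ := hmem x hx v₂ hv₂ _ hu hxv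
  set w := v₂ - s • v₁ with hw
  have hwV : w ∈ V := sub_mem hv₂ (V.smul_mem s hv₁)
  have hwN : w ∉ m • L₀ := fun h => hv₂N (by
    rw [show v₂ = w + s • v₁ by rw [hw]; abel]
    exact add_mem (mem_sup_left h) (mem_sup_right (smul_mem _ s (mem_span_singleton_self v₁))))
  have hxw : x • w ∈ m • m • L₀ := by
    rw [hw, smul_sub, smul_comm x s]
    exact hs
  -- Some `y ∈ m` does not kill `w`, and subtracting a multiple of `x` makes it kill `v₁`.
  obtain ⟨y, hy, hyw⟩ := hnot w hwN
  obtain ⟨t, ht⟩ := hmem y hy v₁ hv₁ _ hu hxv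
  set y' := y - t * x with hy'
  have hy'm : y' ∈ m := sub_mem hy (Ideal.mul_mem_left _ _ hx)
  have hy'v : y' • v₁ ∈ m • m • L₀ := by rwa [hy', sub_smul, mul_smul]
  have hy'w : y' • w ∉ m • m • L₀ := fun h => hyw (by
    rw [show y • w = y' • w + t • x • w by rw [hy', sub_smul, mul_smul]; abel]
    exact add_mem h (smul_mem _ t hxw))
  -- Both `m v₁` and `m w` generate `mV` modulo `m²L`, so `O w + mL = O v₁ + mL` by cancellation.
  have hspan : ∀ u ∈ m • V, u ∉ m • m • L₀ → ∀ v ∈ V,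
      mO * (Ideal.span {v} ⊔ mO * L) ≤ Ideal.span {u} ⊔ mO * (mO * L) := by
    intro u hu huN v hv
    rw [Ideal.mul_sup]
    refine sup_le ?_ le_sup_right
    refine map_mul_span_singleton_le fun z hz => ?_
    obtain ⟨r, hr⟩ := hmem z hz v hv u hu huN
    rw [e₂] at hr
    rw [show z • v = algebraMap R O r * u + (z • v - r • u) by
      rw [Algebra.smul_def, Algebra.smul_def]; ring]
    exact add_mem (mem_sup_left (Ideal.mul_mem_left _ _ (Ideal.mem_span_singleton_self u)))
      (mem_sup_right hr)
  have h1 : mO * (Ideal.span {w} ⊔ mO * L) ≤ mO * (Ideal.span {v₁} ⊔ mO * L) := by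
    refine (hspan _ hu hxv w hwV).trans ?_
    rw [Ideal.mul_sup]
    refine sup_le_sup_right ((Ideal.span_singleton_le_iff_mem _).mpr ?_) _
    rw [Algebra.smul_def]
    exact Ideal.mul_mem_mul (Ideal.mem_map_of_mem _ hx) (Ideal.mem_span_singleton_self _)
  have h2 := (le_sup_left.trans (Ideal.le_of_mul_le_mul_left_of_ne_bot hm h1) :
    Ideal.span {w} ≤ _) (Ideal.mem_span_singleton_self w)
  obtain ⟨c', hc', l, hl, hcl⟩ := mem_sup.mp h2
  obtain ⟨c, rfl⟩ := Ideal.mem_span_singleton'.mp hc'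
  apply hy'w
  rw [← hcl, smul_add, ← mul_smul_comm]
  refine add_mem ?_ (smul_mem_smul hy'm ?_)
  · rw [e₂] at hy'v ⊢
    exact Ideal.mul_mem_left _ c hy'v
  · rw [e₁]
    exact hl

/-- If `O ⧸ mO` has dimension at most three over `R ⧸ m`, then multiplication by `m` does not
increase the index of an `R`-submodule `V` of `L` that contains `m ^ n L`. -/
theorem relCard_smul_le_of_pow_smul_le [m.IsMaximal] [Finite (R ⧸ m)]
    (hm : m.map (algebraMap R O) ≠ ⊥)
    (hcard : cardQuot (m.map (algebraMap R O)) ≤ Nat.card (R ⧸ m) ^ 3) (n : ℕ) :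
    ∀ {L : Ideal O}, L ≠ ⊥ → ∀ {V : Submodule R O}, V ≤ L.restrictScalars R →
      m ^ n • L.restrictScalars R ≤ V →
      relCard (m • V) (m • L.restrictScalars R) ≤ relCard V (L.restrictScalars R) := by
  induction n with
  | zero =>
    intro L _ V hVL hV
    rw [pow_zero, Ideal.one_eq_top, top_smul] at hV
    rw [le_antisymm hVL hV, relCard_eq_one_iff.mpr le_rfl, relCard_eq_one_iff.mpr le_rfl]
  | succ n ih =>
    intro L hL V hVL hV
    set mO := m.map (algebraMap R O) with hmO
    set L₀ := L.restrictScalars R with hL₀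
    have e₁ : m • L₀ = (mO * L).restrictScalars R := smul_restrictScalars_eq m L
    have hL1 : mO * L ≠ ⊥ := mul_ne_zero hm hL
    have hmL : m • L₀ ≤ L₀ := smul_le_right
    have hpow : m ^ n • m • L₀ = m ^ (n + 1) • L₀ := by rw [← mul_smul, ← pow_succ]
    have hV2 : m ^ n • m • L₀ ≤ V ⊓ m • L₀ :=
      le_inf (hpow.le.trans hV) (smul_le_right)
    have h1 := relCard_smul_le_of_smul_le hm hcard hL (sup_le hVL hmL) (le_sup_right : m • L₀ ≤ V ⊔ m • L₀)
    have h2 : relCard (m • (V ⊓ m • L₀)) (m • m • L₀) ≤ relCard (V ⊓ m • L₀) (m • L₀) := by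
      have := ih hL1 (V := V ⊓ m • L₀) (e₁ ▸ inf_le_right) (e₁ ▸ hV2)
      rwa [← e₁] at this
    rw [smul_sup] at h1
    have hfin : Finite (O ⧸ m • (V ⊓ m • L₀)) := by
      refine finite_quotient_of_restrictScalars_le (L := mO * (mO ^ n * (mO * L)))
        (mul_ne_zero hm (mul_ne_zero (pow_ne_zero _ hm) hL1)) ?_
      rw [← smul_restrictScalars_eq]
      refine smul_mono_right _ (le_trans (le_of_eq ?_) hV2)
      rw [e₁, smul_restrictScalars_eq, Ideal.map_pow]
    have h3 : relCard (m • V) (m • V ⊔ m • m • L₀) ≤ relCard (m • (V ⊓ m • L₀)) (m • m • L₀) := by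
      rw [relCard_sup_right]
      exact relCard_le_of_le_left (smul_mono_right m inf_le_left)
    have h4 : relCard (V ⊓ m • L₀) (m • L₀) = relCard V (V ⊔ m • L₀) := by
      rw [relCard_sup_right, relCard_inf_right]
    calc relCard (m • V) (m • L₀)
        = relCard (m • V) (m • V ⊔ m • m • L₀) * relCard (m • V ⊔ m • m • L₀) (m • L₀) :=
          (relCard_mul_relCard le_sup_left
            (sup_le (smul_mono_right _ hVL) (smul_mono_right _ hmL))).symm
      _ ≤ relCard V (V ⊔ m • L₀) * relCard (V ⊔ m • L₀) L₀ :=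
          Nat.mul_le_mul ((h3.trans h2).trans h4.le) h1
      _ = relCard V L₀ := relCard_mul_relCard le_sup_left (sup_le hVL hmL)

theorem relCard_smul_self_le_of_pow_smul_le [m.IsMaximal] [Finite (R ⧸ m)]
    (hm : m.map (algebraMap R O) ≠ ⊥)
    (hcard : cardQuot (m.map (algebraMap R O)) ≤ Nat.card (R ⧸ m) ^ 3) (n : ℕ)
    {L : Ideal O} (hL : L ≠ ⊥) {V : Submodule R O} (hVL : V ≤ L.restrictScalars R)
    (hV : m ^ n • L.restrictScalars R ≤ V) :
    relCard (m • V) V ≤ Nat.card (R ⧸ m) ^ 3 := by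
  have h1 := relCard_smul_le_of_pow_smul_le hm hcard n hL hVL hV
  have h2 := relCard_mul_relCard (smul_le_right : m • V ≤ V) hVL
  have h3 := relCard_mul_relCard (smul_mono_right m hVL)
    (smul_le_right : m • L.restrictScalars R ≤ L.restrictScalars R)
  rw [relCard_smul_restrictScalars hm hL] at h3
  have hfin : Finite (O ⧸ V) := by
    refine finite_quotient_of_restrictScalars_le (L := m.map (algebraMap R O) ^ n * L)
      (mul_ne_zero (pow_ne_zero _ hm) hL) ?_
    rw [← Ideal.map_pow, ← smul_restrictScalars_eq]
    exact hV
  have hpos : 0 < relCard V (L.restrictScalars R) := relCard_pos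
  refine Nat.le_of_mul_le_mul_right ?_ hpos
  rw [h2, ← h3, mul_comm]
  exact Nat.mul_le_mul hcard h1

end

/-! ### Descent of the bound to ideals of `R` -/

/-- If `O ⧸ mO` has dimension at most three over `R ⧸ m`, so has `I ⧸ mI` for every ideal `I` of `R`.
Adding a high power `m ^ k L` of the extension `L` of `I` to `I` does not shrink `I ⧸ mI`, as the
conductor of `R` in `O` is nonzero, and the bound is known for `I + m ^ k L`. -/
theorem relCard_smul_self_le {R O : Type*} [CommRing R] [CommRing O] [IsDedekindDomain O]
    [Algebra R O] [Ring.HasFiniteQuotients O] [FaithfulSMul R O] {m : Ideal R} [m.IsMaximal]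
    [Finite (R ⧸ m)] (hm : m ≠ ⊥) {c : R} (hc : c ≠ 0)
    (hcond : ∀ x : O, ∃ r : R, algebraMap R O r = algebraMap R O c * x)
    (hcard : cardQuot (m.map (algebraMap R O)) ≤ Nat.card (R ⧸ m) ^ 3) {I : Ideal R} (hI : I ≠ ⊥) :
    relCard (m • I) I ≤ Nat.card (R ⧸ m) ^ 3 := by
  have hinj : Function.Injective (algebraMap R O) := FaithfulSMul.algebraMap_injective R O
  have hne : ∀ {J : Ideal R}, J ≠ ⊥ → J.map (algebraMap R O) ≠ ⊥ := fun hJ h =>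
    hJ ((Ideal.map_eq_bot_iff_of_injective hinj).mp h)
  let φ : R →ₗ[R] O := Algebra.linearMap R O
  let I₀ : Submodule R O := map φ I
  let L : Ideal O := I.map (algebraMap R O)
  let L₀ : Submodule R O := L.restrictScalars R
  have hL : L ≠ ⊥ := hne hI
  have hIL : I₀ ≤ L₀ := by
    rintro _ ⟨x, hx, rfl⟩
    exact Ideal.mem_map_of_mem _ hx
  -- The ideal `cL` lies in `I`, as `c` conducts `O` into `R`.
  let Lc : Ideal O := Ideal.span {algebraMap R O c} * L
  have hLc : Lc ≠ ⊥ := mul_ne_zero (by simpa using hc) hL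
  have hLcI : Lc.restrictScalars R ≤ I₀ := by
    have h1 : ∀ y ∈ L, ∀ o : O, algebraMap R O c * (o * y) ∈ I₀ := by
      intro y hy
      induction hy using span_induction with
      | mem y hy =>
        obtain ⟨i, hi, rfl⟩ := hy
        intro o
        obtain ⟨r, hr⟩ := hcond o
        refine ⟨r * i, I.mul_mem_left r hi, ?_⟩
        change algebraMap R O (r * i) = _
        rw [map_mul, hr, mul_assoc]
      | zero => intro o; simp
      | add y y' _ _ h h' =>
        intro o
        rw [mul_add, mul_add]
        exact add_mem (h o) (h' o)
      | smul a y _ h =>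
        intro o
        rw [smul_eq_mul, ← mul_assoc o]
        exact h (o * a)
    intro z hz
    obtain ⟨y, hy, rfl⟩ := Ideal.mem_span_singleton_mul.mp hz
    simpa using h1 y hy 1
  let N : Submodule R O := m • Lc.restrictScalars R
  have hNI : N ≤ m • I₀ := smul_mono_right m hLcI
  have hfN : Finite (O ⧸ N) := finite_quotient_of_restrictScalars_le
    (mul_ne_zero (hne hm) hLc) (smul_restrictScalars_eq m Lc).ge
  -- Modulo `m c L` the modules `m ^ k L` become stationary, and Nakayama's lemma gives `r ≡ 1` modulo
  -- `m` with `r m ^ k L ≤ m I`.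
  obtain ⟨k, hk⟩ := IsArtinian.monotone_stabilizes (R := R) (M := O ⧸ N)
    ⟨fun k => OrderDual.toDual (map N.mkQ (m ^ k • L₀)), fun i j hij =>
      OrderDual.toDual_le_toDual.mpr (map_mono (smul_mono_left (Ideal.pow_le_pow_right hij)))⟩
  have hk1 : map N.mkQ (m ^ k • L₀) = map N.mkQ (m ^ (k + 1) • L₀) := hk (k + 1) (by omega)
  have hk2 : map N.mkQ (m ^ k • L₀) ≤ m • map N.mkQ (m ^ k • L₀) := by
    rw [← map_smul'', ← mul_smul, ← pow_succ', ← hk1]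
  obtain ⟨r, hr, hr0⟩ := exists_sub_one_mem_and_smul_eq_zero_of_fg_of_le_smul m _
    (IsNoetherian.noetherian _) hk2
  have hrN : ∀ z ∈ m ^ k • L₀, r • z ∈ m • I₀ := fun z hz => hNI (by
    have := hr0 _ (mem_map_of_mem hz)
    rwa [← map_smul, mkQ_apply, Quotient.mk_eq_zero] at this)
  let V : Submodule R O := I₀ ⊔ m ^ k • L₀
  have hVL : V ≤ L₀ := sup_le hIL smul_le_right
  -- Hence `I / mI` embeds into `V / mV`.
  have hint : m • V ⊓ I₀ = m • I₀ := by
    refine le_antisymm ?_ (le_inf (smul_mono_right m le_sup_left) smul_le_right)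
    rintro x ⟨hxV, hxI⟩
    have hrx : r • x ∈ m • I₀ := by
      have hx' : x ∈ m • I₀ ⊔ m • m ^ k • L₀ := by
        rw [← smul_sup]; exact hxV
      obtain ⟨y, hy, z, hz, rfl⟩ := mem_sup.mp hx'
      rw [smul_add]
      exact add_mem (smul_mem _ r hy) (hrN z (smul_le_right hz))
    have e : x = r • x - (r - 1) • x := by rw [sub_smul, one_smul, sub_sub_cancel]
    rw [e]
    exact sub_mem hrx (smul_mem_smul hr hxI)
  have hfV : Finite (O ⧸ m • V) := by
    refine finite_quotient_of_restrictScalars_le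
      (L := m.map (algebraMap R O) * ((m ^ k).map (algebraMap R O) * L))
      (mul_ne_zero (hne hm) (mul_ne_zero ?_ hL)) ?_
    · rw [Ideal.map_pow]
      exact pow_ne_zero _ (hne hm)
    · rw [← smul_restrictScalars_eq, ← smul_restrictScalars_eq]
      exact smul_mono_right m le_sup_right
  calc relCard (m • I) I = relCard (map φ (m • I)) I₀ := (relCard_map_of_injective _ _ φ hinj).symm
    _ = relCard (m • I₀) I₀ := by rw [map_smul'']
    _ = relCard (m • V) I₀ := by rw [← hint, relCard_inf_right]
    _ ≤ relCard (m • V) V := relCard_le_of_le_right le_sup_left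
    _ ≤ _ := relCard_smul_self_le_of_pow_smul_le (hne hm) hcard k hL hVL le_sup_right

/-! ### Generators of ideals -/

theorem exists_relCard_sup_span_singleton_le {R M : Type*} [CommRing R] [AddCommGroup M]
    [Module R M] {m : Ideal R} [m.IsMaximal] [Finite (R ⧸ m)] {N P : Submodule R M}
    [Finite (M ⧸ N)] (h : m • P ≤ N) (hNP : N ≤ P) {n : ℕ}
    (hcard : relCard N P ≤ Nat.card (R ⧸ m) ^ (n + 1)) :
    ∃ u ∈ P, relCard (N ⊔ span R {u}) P ≤ Nat.card (R ⧸ m) ^ n := by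
  have hq := one_lt_card_quotient m
  by_cases hPN : P ≤ N
  · refine ⟨0, zero_mem _, ?_⟩
    rw [relCard_eq_one_iff.mpr (hPN.trans le_sup_left)]
    exact Nat.one_le_pow _ _ (by omega)
  · obtain ⟨u, hu, huN⟩ := SetLike.not_le_iff_exists.mp hPN
    refine ⟨u, hu, Nat.le_of_mul_le_mul_left ?_ (by omega : 0 < Nat.card (R ⧸ m))⟩
    rw [← pow_succ']
    exact (card_mul_relCard_le h hNP hu huN).trans hcard

theorem exists_le_sup_span_pair {R M : Type*} [CommRing R] [AddCommGroup M]
    [Module R M] {m : Ideal R} [m.IsMaximal] [Finite (R ⧸ m)] {N P : Submodule R M}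
    [Finite (M ⧸ N)] (h : m • P ≤ N) (hNP : N ≤ P)
    (hcard : relCard N P ≤ Nat.card (R ⧸ m) ^ 2) :
    ∃ y ∈ P, ∃ z ∈ P, P ≤ N ⊔ span R {y} ⊔ span R {z} := by
  obtain ⟨y, hy, hyc⟩ := exists_relCard_sup_span_singleton_le h hNP hcard
  have : Finite (M ⧸ (N ⊔ span R {y})) :=
    Finite.of_surjective _ (factor_surjective (le_sup_left : N ≤ N ⊔ span R {y}))
  obtain ⟨z, hz, hzc⟩ := exists_relCard_sup_span_singleton_le (h.trans le_sup_left)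
    (sup_le hNP ((span_singleton_le_iff_mem _ _).mpr hy)) hyc
  have : Finite (M ⧸ (N ⊔ span R {y} ⊔ span R {z})) :=
    Finite.of_surjective _ (factor_surjective le_sup_left)
  have hpos : 0 < relCard (N ⊔ span R {y} ⊔ span R {z}) P := relCard_pos
  exact ⟨y, hy, z, hz, relCard_eq_one_iff.mp (by rw [pow_zero] at hzc; omega)⟩

/-- The number of generators of an ideal of a one-dimensional domain is determined locally, once it
is at least two: a first generator `x` is chosen to be part of a minimal system of generators at the
maximal ideals containing a given `w ∈ I`, and the others by approximation at those containing
`x`. -/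
theorem exists_eq_span_of_relCard_smul_le {R : Type*} [CommRing R] [IsDomain R]
    [Ring.HasFiniteQuotients R] {I : Ideal R}
    (h : ∀ m : Ideal R, m.IsMaximal → m ≠ ⊥ → I ≠ ⊥ → relCard (m • I) I ≤ Nat.card (R ⧸ m) ^ 3) :
    ∃ a b c : R, I = Ideal.span {a, b, c} := by
  by_cases hI : I = ⊥
  · exact ⟨0, 0, 0, by simp [hI]⟩
  by_cases hItop : I = ⊤
  · exact ⟨1, 1, 1, by simp [hItop]⟩
  obtain ⟨w, hwI, hw0⟩ := exists_mem_ne_zero_of_ne_bot hI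
  have hfinite : ∀ x : R, x ≠ 0 → {n : Ideal R | n.IsMaximal ∧ x ∈ n}.Finite := fun x hx =>
    (Ring.HasFiniteQuotients.finite_setOfPred_mem x hx).subset fun n hn => hn.2
  have hnebot : ∀ {x : R} {n : Ideal R}, x ≠ 0 → x ∈ n → n ≠ ⊥ := by
    rintro x _ hx hxn rfl
    exact hx hxn
  have hproper : ∀ n : Ideal R, n.IsMaximal → ¬ I ≤ n • I := by
    intro n hn hle
    obtain ⟨r, hr, hr0⟩ := exists_sub_one_mem_and_smul_eq_zero_of_fg_of_le_smul n I
      (IsNoetherian.noetherian _) hle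
    have : r = 0 := (mul_eq_zero.mp (hr0 w hwI)).resolve_right hw0
    rw [this, zero_sub] at hr
    exact hn.ne_top (n.eq_top_iff_one.mpr (by simpa using n.neg_mem hr))
  have hf : ∀ n : Ideal R, ∃ x ∈ I, n.IsMaximal → x ∉ n • I := fun n => by
    by_cases hn : n.IsMaximal
    · obtain ⟨x, hx, hx'⟩ := SetLike.not_le_iff_exists.mp (hproper n hn)
      exact ⟨x, hx, fun _ => hx'⟩
    · exact ⟨0, zero_mem _, fun hn' => absurd hn' hn⟩
  choose f hfI hf using hf
  obtain ⟨x, hxI, hx⟩ := exists_mem_forall_sub_mem_smul _ (hfinite w hw0) (fun n hn => hn.1) I f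
    fun n _ => hfI n
  have hxn : ∀ n : Ideal R, n.IsMaximal → w ∈ n → x ∉ n • I := fun n hn hwn hxn =>
    hf n hn (by simpa using sub_mem hxn (hx n ⟨hn, hwn⟩))
  have hx0 : x ≠ 0 := by
    obtain ⟨n, hn, hIn⟩ := Ideal.exists_le_maximal I hItop
    rintro rfl
    exact hxn n hn (hIn hwI) (zero_mem _)
  have hyz : ∀ n : Ideal R, ∃ y ∈ I, ∃ z ∈ I, n.IsMaximal → x ∈ n →
      I ≤ n • I ⊔ span R {x} ⊔ span R {y} ⊔ span R {z} := by
    intro n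
    by_cases hn : n.IsMaximal ∧ x ∈ n
    · obtain ⟨hn, hxmem⟩ := hn
      have hn0 := hnebot hx0 hxmem
      have := Ring.HasFiniteQuotients.finiteQuotient hn0
      have hfin : Finite (R ⧸ n • I) := Ring.HasFiniteQuotients.finiteQuotient
        (mul_ne_zero hn0 hI)
      have hfin' : Finite (R ⧸ (n • I ⊔ span R {x})) :=
        Finite.of_surjective _ (factor_surjective (le_sup_left : n • I ≤ n • I ⊔ span R {x}))
      have hq := one_lt_card_quotient n
      have hcard : relCard (n • I ⊔ span R {x}) I ≤ Nat.card (R ⧸ n) ^ 2 := by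
        by_cases hwn : w ∈ n
        · have h1 := (card_mul_relCard_le le_rfl smul_le_right hxI (hxn n hn hwn)).trans
            (h n hn hn0 hI)
          refine Nat.le_of_mul_le_mul_left (h1.trans_eq ?_) (by omega : 0 < Nat.card (R ⧸ n))
          ring
        -- Away from `w` the ideal `I` is locally the unit ideal, generated by `w`.
        · have h1 : n • I ⊔ span R {w} = I := by
            refine le_antisymm (sup_le smul_le_right ((span_singleton_le_iff_mem _ _).mpr hwI)) ?_
            obtain ⟨y, i, hi, hyi⟩ := hn.exists_inv hwn
            intro p hp
            rw [show p = i * p + (p * y) * w by linear_combination (-p) * hyi]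
            exact add_mem (mem_sup_left (smul_mem_smul hi hp))
              (mem_sup_right (Ideal.mul_mem_left _ _ (mem_span_singleton_self w)))
          have h2 := relCard_sup_span_singleton_le (N := n • I) le_rfl hwI
          rw [h1] at h2
          calc _ ≤ relCard (n • I) I := relCard_le_of_le_left le_sup_left
            _ ≤ _ := h2
            _ ≤ _ := Nat.le_self_pow (by omega) _
      obtain ⟨y, hy, z, hz, hle⟩ := exists_le_sup_span_pair (le_sup_left : n • I ≤ n • I ⊔ span R {x})
        (sup_le smul_le_right ((span_singleton_le_iff_mem _ _).mpr hxI)) hcard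
      exact ⟨y, hy, z, hz, fun _ _ => hle⟩
    · exact ⟨0, zero_mem _, 0, zero_mem _, fun h1 h2 => absurd ⟨h1, h2⟩ hn⟩
  choose g hgI k hkI hgk using hyz
  obtain ⟨y, hyI, hy⟩ := exists_mem_forall_sub_mem_smul _ (hfinite x hx0) (fun n hn => hn.1) I g
    fun n _ => hgI n
  obtain ⟨z, hzI, hz⟩ := exists_mem_forall_sub_mem_smul _ (hfinite x hx0) (fun n hn => hn.1) I k
    fun n _ => hkI n
  refine ⟨x, y, z, le_antisymm ?_ ?_⟩
  · refine le_of_forall_isMaximal_le_sup_smul (IsNoetherian.noetherian _) x ?_ ?_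
    · intro p _
      exact Ideal.mul_mem_right p _ (Ideal.subset_span (by simp))
    · intro n hn hxmem
      have hmem : ∀ t ∈ ({x, y, z} : Set R), t ∈ Ideal.span {x, y, z} ⊔ n • I := fun t ht =>
        mem_sup_left (Ideal.subset_span ht)
      refine (hgk n hn hxmem).trans (sup_le (sup_le (sup_le le_sup_right ?_) ?_) ?_)
      · exact (span_singleton_le_iff_mem _ _).mpr (hmem x (by simp))
      · refine (span_singleton_le_iff_mem _ _).mpr ?_
        rw [← sub_sub_cancel y (g n)]
        exact sub_mem (hmem y (by simp)) (mem_sup_right (hy n ⟨hn, hxmem⟩))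
      · refine (span_singleton_le_iff_mem _ _).mpr ?_
        rw [← sub_sub_cancel z (k n)]
        exact sub_mem (hmem z (by simp)) (mem_sup_right (hz n ⟨hn, hxmem⟩))
  · refine Ideal.span_le.mpr ?_
    rintro _ (rfl | rfl | rfl)
    exacts [hxI, hyI, hzI]

theorem span_triple_ne_top_of_card_lt {k B : Type*} [Field k] [Finite k] [AddCommGroup B]
    [Module k B] [Finite B] (h : Nat.card k ^ 3 < Nat.card B) (x y z : B) :
    span k {x, y, z} ≠ ⊤ := by
  classical
  intro htop
  have h1 := finrank_span_finset_le_card (R := k) ({x, y, z} : Finset B)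
  rw [Set.finrank, Finset.coe_insert, Finset.coe_insert, Finset.coe_singleton, htop,
    finrank_top] at h1
  have h2 : finrank k B ≤ 3 := h1.trans Finset.card_le_three
  rw [Module.natCard_eq_pow_finrank (K := k) (V := B)] at h
  exact absurd h (not_lt.mpr (Nat.pow_le_pow_right Finite.one_lt_card.le h2))

/-- If `R + mO` is super-multiplicative, then `O ⧸ mO` has dimension at most three over `R ⧸ m`. -/
theorem cardQuot_map_le_of_isSuperMultiplicative {R F : Type*} [CommRing R] [Field F] [Algebra R F]
    [FaithfulSMul R F] {O : Subalgebra R F} [IsDedekindDomain O] [Ring.HasFiniteQuotients O]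
    {m : Ideal R} [m.IsMaximal] [Finite (R ⧸ m)] [Ring.HasFiniteQuotients (scalarOverring O m)]
    (hm : m ≠ ⊥) (h : IsSuperMultiplicative (scalarOverring O m)) :
    cardQuot (m.map (algebraMap R O)) ≤ Nat.card (R ⧸ m) ^ 3 := by
  classical
  let : Field (R ⧸ m) := Ideal.Quotient.field m
  set mO := m.map (algebraMap R O) with hmO
  have hinj : Function.Injective (algebraMap R O) := by
    have h1 := FaithfulSMul.algebraMap_injective R F
    rw [IsScalarTower.algebraMap_eq R O F] at h1
    exact Function.Injective.of_comp (f := algebraMap O F) h1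
  have hmO0 : mO ≠ ⊥ := fun h => hm ((Ideal.map_eq_bot_iff_of_injective hinj).mp h)
  have hfin : Finite (O ⧸ mO) := Ring.HasFiniteQuotients.finiteQuotient hmO0
  by_contra! hlt
  have h4 : ∀ a b : O ⧸ mO, span (R ⧸ m) {1, a, b} ≠ ⊤ := by
    rw [cardQuot_apply] at hlt
    exact fun a b => span_triple_ne_top_of_card_lt hlt 1 a b
  have hprin : ∀ x y : O ⧸ mO, ∃ d, Ideal.span {x, y} = Ideal.span {d} := by
    intro x y
    let J : Ideal O := (Ideal.span {x, y}).comap (Ideal.Quotient.mk mO)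
    have hJ : mO ≤ J := fun z hz => by
      rw [Ideal.mem_comap, Ideal.Quotient.eq_zero_iff_mem.mpr hz]
      exact zero_mem _
    obtain ⟨a, ha⟩ := IsDedekindDomain.exists_sup_span_eq hJ hmO0
    refine ⟨Ideal.Quotient.mk mO a, ?_⟩
    have h1 := congrArg (Ideal.map (Ideal.Quotient.mk mO)) ha
    rw [Ideal.map_comap_of_surjective _ Ideal.Quotient.mk_surjective, Ideal.map_sup,
      Ideal.map_quotient_self, bot_sup_eq, Ideal.map_span, Set.image_singleton] at h1
    exact h1.symm
  obtain ⟨a, b, ha, hb, hab⟩ := exists_mul_notMem_span h4 hprin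
  obtain ⟨a, rfl⟩ := Ideal.Quotient.mk_surjective a
  obtain ⟨b, rfl⟩ := Ideal.Quotient.mk_surjective b
  exact not_isSuperMultiplicative_scalarOverring hm ha hb hab h

theorem mainTheorem1 (K : Type*) [Field K] [NumberField K] (R : Subring K) :
    (∀ I : Ideal R, ∃ a b c : R, I = Ideal.span {a, b, c}) ↔
      (∀ R' : Subalgebra R (FractionRing R), R' ≤ integralClosure R (FractionRing R) →
        IsSuperMultiplicative R') := by
  let f : FractionRing R →+* K := IsFractionRing.lift (g := R.subtype) R.subtype_injective
  have hF : NumberField (FractionRing R) := numberField_of_injective f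
  have hFQ : ∀ R' : Subalgebra R (FractionRing R), Ring.HasFiniteQuotients R' := fun R' =>
    hasFiniteQuotients_of_injective_numberField R'.val.toRingHom Subtype.val_injective
  constructor
  · intro h R' _
    have := hFQ R'
    exact isSuperMultiplicative_of_forall_eq_span fun L =>
      exists_eq_span_of_overring h R' L (IsNoetherian.noetherian L)
  · intro h I
    have hR : Ring.HasFiniteQuotients R :=
      hasFiniteQuotients_of_injective_numberField R.subtype R.subtype_injective
    let O := integralClosure R (FractionRing R)
    have hO : Ring.HasFiniteQuotients O := hFQ O
    have hOi : IsIntegrallyClosed O :=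
      integralClosure.isIntegrallyClosedOfFiniteExtension (FractionRing R)
    have hOD : IsDedekindDomain O := { }
    obtain ⟨c, hc, hcond⟩ := exists_mul_mem_range_of_isIntegral R (FractionRing R)
    refine exists_eq_span_of_relCard_smul_le fun m hm hm0 hI => ?_
    have := Ring.HasFiniteQuotients.finiteQuotient hm0
    have := hFQ (scalarOverring O m)
    refine relCard_smul_self_le (O := O) hm0 hc (fun x => ?_)
      (cardQuot_map_le_of_isSuperMultiplicative hm0 (h _ scalarOverring_le)) hI
    obtain ⟨r, hr⟩ := hcond x x.2
    exact ⟨r, Subtype.ext hr⟩
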